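/- Let $\alpha>0$, $\alpha\neq 1$, and let $\mu$ be a $\sigma$-finite measure on a measurable space $\mathbb{X}$. All probability measures $P$ considered are absolutely continuous with respect to $\mu$ with density $p=dP/d\mu\in L^\alpha(\mu)$. Put $\rho=\alpha^{-1}-1$ and define the relative $\alpha$-entropy $$\mathscr{I}_\alpha(P,R)=\frac1\rho\log\bigl[\operatorname{sgn}(\rho)\,I_f(P',R')+1\bigr]\in[0,\infty],$$ where $P'$ has $\mu$-density $p'=p^\alpha/\int p^\alpha d\mu$ (likewise $R'$, $r'$), $f(u)=\operatorname{sgn}(\rho)(u^{1+\rho}-1)$ and $I_f(P',R')=\int r' f(p'/r')\,d\mu$, with $0\cdot f(0/0)=0$ and, for $a>0$, $0\cdot f(a/0)=\infty$ if $\rho>0$ and $0\cdot f(a/0)=0$ if $\rho<0$. Let $B(R,\infty)=\{P:\mathscr{I}_\alpha(P,R)<\infty\}$. A forward $\mathscr{I}_\alpha$-projection of $R$ on a set $\mathbb{E}$ of probability measures with $\mathbb{E}\cap B(R,\infty)\ne\emptyset$ is a $Q\in\mathbb{E}$ with $\mathscr{I}_\alpha(Q,R)=\inf_{P\in\mathbb{E}}\mathscr{I}_\alpha(P,R)$.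 Let $f_\gamma:\mathbb{X}\to\mathbb{R}$ $(\gamma\in\Gamma)$ be measurable, let $\mathbb{L}=\{P: f_\gamma\in L^1(P),\ \int f_\gamma\,dP=0\ \ \forall\gamma\in\Gamma\}$, and let $R$ be a probability measure with $\mu$-density $r$. Suppose that the linear span of $\{f_\gamma\}_{\gamma\in\Gamma}$ is $L^1(P)$-closed for every $P\in\mathbb{L}$ (this holds, for example, whenever $\Gamma$ is finite). Then $Q\in\mathbb{L}$ is the forward $\mathscr{I}_\alpha$-projection of $R$ on $\mathbb{L}$ if and only if there are a scalar $c\in\mathbb{R}$, a function $g$ in the linear span of $\{f_\gamma\}$ and a measurable set $N\subseteq\mathbb{X}$ such that the $\mu$-density $q$ of $Q$ satisfies, $\mu$-almost everywhere, $$q(x)^{\alpha-1}=c\,r(x)^{\alpha-1}+g(x)\quad (x\notin N),\qquad q(x)=0\quad (x\in N)$$ (with $0^{\alpha-1}=\infty$ if $\alpha<1$), and, for every $P\in\mathbb{L}\cap B(R,\infty)$, $$P(N)=0\ \text{ if }\alpha<1,\qquad c\int_N r^{\alpha-1}\,dP\le\int_{\mathbb{X}\setminus N} g\,dP\ \text{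 if }\alpha>1.$$ Moreover, for $\alpha>1$, every scalar $c$, every $g$ in the span, every measurable $N$ and every $P\in\mathbb{L}$, the last inequality is equivalent to $$\int_N\bigl(c\,r^{\alpha-1}+g\bigr)\,dP\le 0 .$$ -/

import Mathlib

open MeasureTheory
open scoped ENNReal

noncomputable section

namespace RelAlpha

variable {X : Type*} [MeasurableSpace X]

/-- The integral `∫ F dμ` of an extended-real function, as an extended real:
the integral of the positive part minus the integral of the negative part. -/
def extIntegral (μ : Measure X) (F : X → EReal) : EReal :=
  ((∫⁻ x, (F x).toENNReal ∂μ : ℝ≥0∞) : EReal) - ((∫⁻ x, (-F x).toENNReal ∂μ : ℝ≥0∞) : EReal)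

/-- The integrand `b * f (a / b)` of Csiszár's divergence, with
`f u = sgn ρ * (u ^ (1 + ρ) - 1)` and the conventions `0 * f (0 / 0) = 0` and, for `a > 0`,
`0 * f (a / 0) = ∞` if `ρ > 0` and `0 * f (a / 0) = 0` if `ρ < 0`. -/
def csiszarTerm (ρ : ℝ) (a b : ℝ≥0∞) : EReal :=
  if b = 0 then
    if a = 0 then 0 else if 0 < ρ then ⊤ else 0
  else
    ((b.toReal * (Real.sign ρ * ((a.toReal / b.toReal) ^ (1 + ρ) - 1)) : ℝ) : EReal)

/-- Csiszár's `f`-divergence `I_f(P, Q) = ∫ q f(p / q) dμ`, where `p` and `q` are the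
`μ`-densities of `P` and `Q`. -/
def csiszarDiv (μ : Measure X) (ρ : ℝ) (P Q : Measure X) : EReal :=
  extIntegral μ fun x => csiszarTerm ρ (P.rnDeriv μ x) (Q.rnDeriv μ x)

/-- The escort measure `P'`, with `μ`-density `p ^ α / ∫ p ^ α dμ`. -/
def escort (μ : Measure X) (α : ℝ) (P : Measure X) : Measure X :=
  μ.withDensity fun x => P.rnDeriv μ x ^ α / ∫⁻ y, P.rnDeriv μ y ^ α ∂μ

/-- The relative `α`-entropy `(1 / ρ) * log (sgn ρ * I_f(P', Q') + 1)` with `ρ = 1 / α - 1`.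
`ENNReal.log` is the logarithm with `log 0 = -∞` and `log ∞ = ∞`; its argument is
nonnegative for all probability measures in the scope of the definition. -/
def relEntropy (μ : Measure X) (α : ℝ) (P Q : Measure X) : EReal :=
  (((α⁻¹ - 1)⁻¹ : ℝ) : EReal) *
    ENNReal.log
      (((Real.sign (α⁻¹ - 1) : ℝ) : EReal) *
        csiszarDiv μ (α⁻¹ - 1) (escort μ α P) (escort μ α Q) + 1).toENNReal

/-- The standing assumption on probability measures: absolutely continuous with respect to `μ`,
with a density in `L^α(μ)`. -/
structure Admissible (μ : Measure X) (α : ℝ) (P : Measure X) : Prop where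
  isProb : IsProbabilityMeasure P
  ac : P ≪ μ
  memLp : MemLp (P.rnDeriv μ) (ENNReal.ofReal α) μ

/-- The set `B(R, ∞)` of probability measures at finite relative `α`-entropy from `R`. -/
def finiteBall (μ : Measure X) (α : ℝ) (R : Measure X) : Set (Measure X) :=
  {P | Admissible μ α P ∧ relEntropy μ α P R < ⊤}

/-- `Q` is a forward projection of `R` on the set `E`. -/
def IsForwardProjection (μ : Measure X) (α : ℝ) (E : Set (Measure X)) (R Q : Measure X) : Prop :=
  (∃ P ∈ E, relEntropy μ α P R < ⊤) ∧ Q ∈ E ∧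
    relEntropy μ α Q R = ⨅ P ∈ E, relEntropy μ α P R

/-- The linear family determined by the constraint functions `f γ`. -/
def linearFamily (μ : Measure X) (α : ℝ) {Γ : Type*} (f : Γ → X → ℝ) : Set (Measure X) :=
  {P | Admissible μ α P ∧ ∀ γ, Integrable (f γ) P ∧ ∫ x, f γ x ∂P = 0}

/-- The linear span of the constraint functions. -/
def constraintSpan {Γ : Type*} (f : Γ → X → ℝ) : Submodule ℝ (X → ℝ) :=
  Submodule.span ℝ (Set.range f)

/-- The span of the constraint functions is closed in `L¹(P)`. -/
def SpanClosedL1 {Γ : Type*} (f : Γ → X → ℝ) (P : Measure X) : Prop :=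
  IsClosed {h : Lp ℝ 1 P | ∃ g ∈ constraintSpan f, h =ᵐ[P] g}

/-- The inequality `c ∫_N r ^ (α - 1) dP ≤ ∫_{X \ N} g dP`, used for `α > 1`. -/
def SideIneq (μ : Measure X) (α : ℝ) (R : Measure X) (c : ℝ) (g : X → ℝ) (N : Set X)
    (P : Measure X) : Prop :=
  c * ∫ x in N, (R.rnDeriv μ x).toReal ^ (α - 1) ∂P ≤ ∫ x in Nᶜ, g x ∂P

/-- The `μ`-density `q` of `Q` has the power-law form with parameters `c`, `g`, `N` relative to
`R` and the set `E`. The equation between powers is read in the extended reals, so that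
`0 ^ (α - 1) = ∞` when `α < 1`. -/
structure HasPowerLaw (μ : Measure X) (α : ℝ) (E : Set (Measure X)) (R Q : Measure X)
    (c : ℝ) (g : X → ℝ) (N : Set X) : Prop where
  measurable_N : MeasurableSet N
  density_off : ∀ᵐ x ∂μ, x ∉ N →
    ((Q.rnDeriv μ x ^ (α - 1) : ℝ≥0∞) : EReal) =
      (c : EReal) * ((R.rnDeriv μ x ^ (α - 1) : ℝ≥0∞) : EReal) + (g x : EReal)
  density_on : ∀ᵐ x ∂μ, x ∈ N → Q.rnDeriv μ x = 0
  side_lt_one : α < 1 → ∀ P ∈ E ∩ finiteBall μ α R, P N = 0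
  side_one_lt : 1 < α → ∀ P ∈ E ∩ finiteBall μ α R, SideIneq μ α R c g N P

end RelAlpha

end

/-! Substituting the escort densities collapses the `f`-divergence: up to a factor depending only on
`R`, the entropy is `1/ρ` times the logarithm of `S(P) / ‖p‖_α`, where `S(P) = ∫ r ^ (α - 1) dP` is
`crossMass μ α R P` and `‖p‖_α` is the `α⁻¹`-th power of `powMass μ α P` (`relEntropy_eq`). A
projection thus minimises this quotient if `α < 1` and maximises it if `α > 1`. The numerator is
affine in `P`, and the denominator has a one-sided derivative along mixtures.

Necessity. Write `M = ∫ q ^ α dμ` and `a = S(Q)`. Differentiating along `(1 - t) Q + t P` at `t = 0`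
gives `a ∫ q ^ (α - 1) dP ≤ M S(P)` for `α < 1`, and the reverse for `α > 1`
(`crossMass_variation_of_lt_one`, `crossMass_variation_of_one_lt`). Take for `P` the reweightings
`(1 + e (h - ∫ h dQ)) Q`, with `h` bounded and annihilating the constraints. Both signs of `e` are
allowed, so `h` annihilates `q ^ (α - 1) - (M / a) r ^ (α - 1)` as well. By Hahn–Banach and the
duality of `L¹` and `L^∞`, this function lies in the closed span, which is the power law with `c = M
/ a` on `{q ≠ 0}`. With `N = {q = 0}`, the condition on `N` is what the variational inequality says
for a general `P`.

Sufficiency. Integrating the power law against `Q` kills `g` and gives `M = c a`, so `c > 0`.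
Integrating it against `P` and using the condition on `N` gives `∫ q ^ (α - 1) dP = c S(P)` for `α <
1`, and `≥` for `α > 1`. Hölder's inequality (reversed for `α < 1`) compares `∫ q ^ (α - 1) dP` with
`‖p‖_α ‖q‖_α ^ (α - 1)`, and cancelling `c` leaves the optimality of `Q`. -/

open MeasureTheory Filter
open scoped ENNReal Topology

namespace RelAlpha

variable {X : Type*} [MeasurableSpace X]

/-! ### Duality in `L¹(Q)` and the constraint span -/

/-- Every continuous linear functional on `L¹` of a probability measure is integration against
a bounded measurable function. -/
theorem exists_bounded_density_of_dual_L1 (Q : Measure X) [IsProbabilityMeasure Q]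
    (φ : Lp ℝ 1 Q →L[ℝ] ℝ) :
    ∃ h : X → ℝ, Measurable h ∧ (∃ K, ∀ x, |h x| ≤ K) ∧
      ∀ v : Lp ℝ 1 Q, φ v = ∫ x, h x * v x ∂Q := by
  have h12 : ∀ v : Lp ℝ 2 Q, MemLp v 1 Q := fun v => (Lp.memLp v).mono_exponent (by norm_num)
  -- For a probability measure `L²` embeds continuously in `L¹`, so `φ` restricts to `L²`, where the
  -- Riesz theorem supplies a kernel `k`.
  let T₀ : Lp ℝ 2 Q →ₗ[ℝ] ℝ :=
    { toFun := fun v => φ ((h12 v).toLp v)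
      map_add' := fun v w => by
        rw [← map_add, ← MemLp.toLp_add]
        congr 1
        exact MemLp.toLp_congr _ _ (Lp.coeFn_add v w)
      map_smul' := fun c v => by
        rw [RingHom.id_apply, ← map_smul, ← MemLp.toLp_const_smul]
        congr 1
        exact MemLp.toLp_congr _ _ (Lp.coeFn_smul c v) }
  let T : Lp ℝ 2 Q →L[ℝ] ℝ := T₀.mkContinuous ‖φ‖ fun v => by
    refine (φ.le_opNorm _).trans (mul_le_mul_of_nonneg_left ?_ (norm_nonneg _))
    rw [Lp.norm_toLp, Lp.norm_def]
    refine ENNReal.toReal_mono (Lp.eLpNorm_ne_top v) ?_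
    exact eLpNorm_le_eLpNorm_of_exponent_le (by norm_num) (Lp.aestronglyMeasurable v)
  let k : Lp ℝ 2 Q := (InnerProductSpace.toDual ℝ _).symm T
  have hkint : Integrable k Q := memLp_one_iff_integrable.1 (h12 k)
  have hset : ∀ s (hs : MeasurableSet s),
      φ (indicatorConstLp 1 hs (measure_ne_top Q s) (1 : ℝ)) = ∫ x in s, k x ∂Q := by
    intro s hs
    have h1 : T (indicatorConstLp 2 hs (measure_ne_top Q s) (1 : ℝ)) = ∫ x in s, k x ∂Q := by
      rw [← InnerProductSpace.toDual_symm_apply (𝕜 := ℝ), real_inner_comm,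
        L2.inner_indicatorConstLp_one]
    rw [← h1]
    change φ _ = φ _
    congr 1
    refine MemLp.toLp_congr _ _ ?_
    exact (indicatorConstLp_coeFn (p := 2) (hs := hs) (hμs := measure_ne_top Q s)).symm
  -- Testing on indicators bounds every average of `k` by `‖φ‖`, hence `|k| ≤ ‖φ‖` almost
  -- everywhere; clipping `k` makes the bound hold everywhere.
  have hbd : ∀ s, MeasurableSet s → |∫ x in s, k x ∂Q| ≤ ‖φ‖ * Q.real s := by
    intro s hs
    rw [← hset s hs]
    refine (φ.le_opNorm _).trans (le_of_eq ?_)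
    rw [norm_indicatorConstLp one_ne_zero ENNReal.one_ne_top]
    simp
  have hup : k ≤ᵐ[Q] fun _ => ‖φ‖ := by
    refine ae_le_of_forall_setIntegral_le hkint (integrable_const _) fun s hs _ => ?_
    rw [setIntegral_const, smul_eq_mul, mul_comm]
    exact (le_abs_self _).trans (hbd s hs)
  have hlo : (fun _ => -‖φ‖) ≤ᵐ[Q] k := by
    refine ae_le_of_forall_setIntegral_le (integrable_const _) hkint fun s hs _ => ?_
    rw [setIntegral_const, smul_eq_mul, mul_comm, neg_mul]
    exact neg_le_of_abs_le (hbd s hs)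
  let h : X → ℝ := fun x => max (-‖φ‖) (min (k x) ‖φ‖)
  have hm : Measurable h := measurable_const.max
    ((Lp.stronglyMeasurable k).measurable.min measurable_const)
  have hK : ∀ x, |h x| ≤ ‖φ‖ := fun x => abs_le.2
    ⟨le_max_left _ _, max_le (by linarith [norm_nonneg φ]) (min_le_right _ _)⟩
  have hhk : h =ᵐ[Q] k := by
    filter_upwards [hup, hlo] with x h1 h2
    simp only [h]
    rw [min_eq_left h1, max_eq_right h2]
  refine ⟨h, hm, ⟨_, hK⟩, fun v => ?_⟩
  have hLinf : MemLp h ⊤ Q := memLp_top_of_bound hm.aestronglyMeasurable _ (ae_of_all _ hK)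
  let ψ : Lp ℝ 1 Q →L[ℝ] ℝ := (ContinuousLinearMap.mul ℝ ℝ).lpPairing Q ⊤ 1 (hLinf.toLp h)
  have hψ : ∀ w : Lp ℝ 1 Q, ψ w = ∫ x, h x * w x ∂Q := by
    intro w
    rw [ContinuousLinearMap.lpPairing_eq_integral]
    refine integral_congr_ae ?_
    filter_upwards [hLinf.coeFn_toLp] with x hx
    simp [hx]
  rw [← hψ]
  induction v using Lp.induction ENNReal.one_ne_top with
  | @indicatorConst c s hs hμs =>
    have hc : (Lp.simpleFunc.indicatorConst 1 hs hμs.ne c : Lp ℝ 1 Q)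
        = c • indicatorConstLp 1 hs hμs.ne (1 : ℝ) := by
      rw [Lp.simpleFunc.coe_indicatorConst, indicatorConstLp, indicatorConstLp,
        ← MemLp.toLp_const_smul]
      refine MemLp.toLp_congr _ _ (ae_of_all _ fun x => ?_)
      by_cases hx : x ∈ s <;> simp [hx]
    rw [hc, map_smul, map_smul, hset s hs, hψ]
    congr 1
    rw [← integral_indicator hs]
    refine integral_congr_ae ?_
    filter_upwards [hhk, indicatorConstLp_coeFn (p := 1) (hs := hs) (hμs := hμs.ne) (c := (1 : ℝ))]
      with x h1 h2
    rw [h2, h1]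
    by_cases hx : x ∈ s <;> simp [hx]
  | add hf hg _ hf' hg' => rw [map_add, map_add, hf', hg']
  | isClosed => exact isClosed_eq φ.continuous ψ.continuous

theorem integrable_of_mem_constraintSpan {Γ : Type*} {f : Γ → X → ℝ} {P : Measure X}
    (hf : ∀ γ, Integrable (f γ) P) {g : X → ℝ} (hg : g ∈ constraintSpan f) : Integrable g P := by
  induction hg using Submodule.span_induction with
  | mem x hx => obtain ⟨γ, rfl⟩ := hx; exact hf γ
  | zero => exact integrable_zero _ _ _
  | add x y _ _ hx hy => exact hx.add hy
  | smul a x _ hx => exact hx.smul a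

theorem integral_eq_zero_of_mem_constraintSpan {Γ : Type*} {f : Γ → X → ℝ} {P : Measure X}
    (hf : ∀ γ, Integrable (f γ) P) (hz : ∀ γ, ∫ x, f γ x ∂P = 0)
    {g : X → ℝ} (hg : g ∈ constraintSpan f) : ∫ x, g x ∂P = 0 := by
  induction hg using Submodule.span_induction with
  | mem x hx => obtain ⟨γ, rfl⟩ := hx; exact hz γ
  | zero => simp
  | add x y hx' hy' hx hy =>
    simp only [Pi.add_apply]
    rw [integral_add (integrable_of_mem_constraintSpan hf hx')
      (integrable_of_mem_constraintSpan hf hy'), hx, hy, add_zero]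
  | smul a x _ hx => simp only [Pi.smul_apply]; rw [integral_smul, hx, smul_zero]

/-- The classes in `L¹(P)` of the elements of the constraint span, as a submodule. -/
def spanL1 {Γ : Type*} (f : Γ → X → ℝ) (P : Measure X) : Submodule ℝ (Lp ℝ 1 P) where
  carrier := {h : Lp ℝ 1 P | ∃ g ∈ constraintSpan f, h =ᵐ[P] g}
  zero_mem' := ⟨0, Submodule.zero_mem _, Lp.coeFn_zero ℝ 1 P⟩
  add_mem' := by
    rintro a b ⟨g, hg, hag⟩ ⟨k, hk, hbk⟩
    exact ⟨g + k, Submodule.add_mem _ hg hk, (Lp.coeFn_add a b).trans (hag.add hbk)⟩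
  smul_mem' := by
    rintro c a ⟨g, hg, hag⟩
    exact ⟨c • g, Submodule.smul_mem _ c hg, (Lp.coeFn_smul c a).trans (hag.const_smul c)⟩

/-- The span of finitely many integrable functions is closed in `L¹`. -/
theorem spanClosedL1_of_finite {Γ : Type*} [Finite Γ] {f : Γ → X → ℝ} {P : Measure X}
    (hf : ∀ γ, Integrable (f γ) P) : SpanClosedL1 f P := by
  let Φ : constraintSpan f →ₗ[ℝ] Lp ℝ 1 P :=
    { toFun := fun g => (integrable_of_mem_constraintSpan hf g.2).toL1 g.1
      map_add' := fun _ _ => rfl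
      map_smul' := fun _ _ => rfl }
  have hfin : FiniteDimensional ℝ (constraintSpan f) :=
    FiniteDimensional.span_of_finite ℝ (Set.finite_range f)
  have hrange : {h : Lp ℝ 1 P | ∃ g ∈ constraintSpan f, h =ᵐ[P] g} = Φ.range := by
    ext h
    constructor
    · rintro ⟨g, hg, hhg⟩
      refine ⟨⟨g, hg⟩, Lp.ext ?_⟩
      exact (Integrable.coeFn_toL1 (integrable_of_mem_constraintSpan hf hg)).trans hhg.symm
    · rintro ⟨g, rfl⟩
      exact ⟨g.1, g.2, Integrable.coeFn_toL1 (integrable_of_mem_constraintSpan hf g.2)⟩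
  rw [SpanClosedL1, hrange]
  exact Submodule.closed_of_finiteDimensional _

/-- If the constraint span is closed in `L¹(Q)`, then an integrable function that is annihilated
by all bounded annihilators of the constraints belongs to the span. -/
theorem exists_mem_constraintSpan_of_annihilator {Γ : Type*} {f : Γ → X → ℝ} {Q : Measure X}
    [IsProbabilityMeasure Q] (hf : ∀ γ, Integrable (f γ) Q) (hcl : SpanClosedL1 f Q)
    {u : X → ℝ} (hu : Integrable u Q)
    (H : ∀ h : X → ℝ, Measurable h → (∃ K, ∀ x, |h x| ≤ K) →
      (∀ γ, ∫ x, h x * f γ x ∂Q = 0) → ∫ x, h x * u x ∂Q = 0) :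
    ∃ g ∈ constraintSpan f, u =ᵐ[Q] g := by
  by_contra hno
  have hmem : hu.toL1 u ∉ (spanL1 f Q : Set (Lp ℝ 1 Q)) := by
    rintro ⟨g, hg, hug⟩
    exact hno ⟨g, hg, hu.coeFn_toL1.symm.trans hug⟩
  obtain ⟨φ, s, hφ, hs⟩ := geometric_hahn_banach_closed_point (spanL1 f Q).convex hcl hmem
  have hpos : 0 < φ (hu.toL1 u) := by
    have := hφ 0 (Submodule.zero_mem _)
    rw [map_zero] at this
    exact this.trans hs
  -- A functional bounded above on a subspace vanishes there: otherwise some multiple of `a` would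
  -- attain the separating value `s`.
  have hzero : ∀ a ∈ spanL1 f Q, φ a = 0 := by
    intro a ha
    by_contra hne
    have := hφ ((s / φ a) • a) (Submodule.smul_mem _ _ ha)
    rw [map_smul, smul_eq_mul, div_mul_cancel₀ _ hne] at this
    exact lt_irrefl _ this
  obtain ⟨h, hm, hK, hφh⟩ := exists_bounded_density_of_dual_L1 Q φ
  have key : ∀ {v : X → ℝ} (hv : Integrable v Q), φ (hv.toL1 v) = ∫ x, h x * v x ∂Q := by
    intro v hv
    rw [hφh]
    refine integral_congr_ae ?_
    filter_upwards [hv.coeFn_toL1] with x hx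
    rw [hx]
  refine hpos.ne' ?_
  rw [key hu]
  refine H h hm hK fun γ => ?_
  rw [← key (hf γ)]
  exact hzero _ ⟨f γ, Submodule.subset_span ⟨γ, rfl⟩, (hf γ).coeFn_toL1⟩

/-! ### Power integrals and the closed form of the relative entropy -/

/-- The integral `∫ p ^ α dμ`, where `p` is the `μ`-density of `P`. -/
noncomputable def powMass (μ : Measure X) (α : ℝ) (P : Measure X) : ℝ≥0∞ :=
  ∫⁻ x, P.rnDeriv μ x ^ α ∂μ

/-- The integral `∫ q ^ (α - 1) dP`, where `q` is the `μ`-density of `Q`. -/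
noncomputable def crossMass (μ : Measure X) (α : ℝ) (Q P : Measure X) : ℝ≥0∞ :=
  ∫⁻ x, Q.rnDeriv μ x ^ (α - 1) ∂P

theorem csiszarTerm_of_ne_zero {ρ : ℝ} {a b : ℝ≥0∞} (ha : a ≠ ⊤) (hb : b ≠ ⊤) (hb0 : b ≠ 0)
    (hρ1 : -1 < ρ) :
    ∃ t B : ℝ, 0 ≤ t ∧ 0 ≤ B ∧ b = ENNReal.ofReal B ∧
      a ^ (1 + ρ) * b ^ (-ρ) = ENNReal.ofReal t ∧
      csiszarTerm ρ a b = ((Real.sign ρ * (t - B) : ℝ) : EReal) := by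
  have hB : 0 < b.toReal := ENNReal.toReal_pos hb0 hb
  have hA : 0 ≤ a.toReal := ENNReal.toReal_nonneg
  refine ⟨a.toReal ^ (1 + ρ) * b.toReal ^ (-ρ), b.toReal, by positivity, hB.le,
    (ENNReal.ofReal_toReal hb).symm, ?_, ?_⟩
  · rw [ENNReal.ofReal_mul (by positivity), ← ENNReal.ofReal_rpow_of_nonneg hA (by linarith),
      ← ENNReal.ofReal_rpow_of_pos hB, ENNReal.ofReal_toReal ha, ENNReal.ofReal_toReal hb]
  · rw [csiszarTerm, if_neg hb0, EReal.coe_eq_coe_iff, Real.div_rpow hA hB.le,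
      Real.rpow_add hB, Real.rpow_one, Real.rpow_neg hB.le]
    have := (Real.rpow_pos_of_pos hB ρ).ne'
    field_simp

/-- The identity between `t - B` and its positive and negative parts, arranged without subtraction
so that it survives integration in `ℝ≥0∞`. -/
theorem ofReal_sub_add_ofReal {t B : ℝ} (ht : 0 ≤ t) (hB : 0 ≤ B) :
    ENNReal.ofReal (t - B) + ENNReal.ofReal B = ENNReal.ofReal t + ENNReal.ofReal (B - t) := by
  rcases le_total t B with h | h
  · rw [ENNReal.ofReal_of_nonpos (sub_nonpos.2 h), zero_add,
      ← ENNReal.ofReal_add ht (sub_nonneg.2 h), add_sub_cancel]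
  · rw [ENNReal.ofReal_of_nonpos (sub_nonpos.2 h), add_zero,
      ← ENNReal.ofReal_add (sub_nonneg.2 h) hB, sub_add_cancel]

/-- The conventions at `b = 0` are those of `ℝ≥0∞`: for `a > 0` the product `a ^ (1 + ρ) * 0 ^ (-ρ)`
is `∞`, and for `a = 0` it is `0`. The bound by `b` makes the negative part integrable, so that `∞ -
∞` cannot occur. -/
theorem toENNReal_csiszarTerm_of_pos {ρ : ℝ} (hρ : 0 < ρ) {a b : ℝ≥0∞} (ha : a ≠ ⊤) (hb : b ≠ ⊤) :
    (csiszarTerm ρ a b).toENNReal + b = a ^ (1 + ρ) * b ^ (-ρ) + (-csiszarTerm ρ a b).toENNReal ∧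
      (-csiszarTerm ρ a b).toENNReal ≤ b := by
  have hρ1 : 0 < 1 + ρ := by linarith
  rcases eq_or_ne b 0 with rfl | hb0
  · rcases eq_or_ne a 0 with rfl | ha0
    · simp [csiszarTerm, hρ1]
    · have : a ^ (1 + ρ) ≠ 0 := by simp [ha0, hρ1, hρ1.not_gt]
      simp [csiszarTerm, ha0, hρ, ENNReal.zero_rpow_of_neg, ENNReal.mul_top this]
  · obtain ⟨t, B, ht, hB, h1, h2, h3⟩ := csiszarTerm_of_ne_zero ha hb hb0 (by linarith : -1 < ρ)
    rw [h2, h3, h1, Real.sign_of_pos hρ, one_mul, ← EReal.coe_neg, neg_sub]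
    simp only [EReal.real_coe_toENNReal]
    exact ⟨ofReal_sub_add_ofReal ht hB, ENNReal.ofReal_le_ofReal (by linarith)⟩

theorem toENNReal_csiszarTerm_of_neg {ρ : ℝ} (hρ : ρ < 0) (hρ1 : -1 < ρ) {a b : ℝ≥0∞}
    (ha : a ≠ ⊤) (hb : b ≠ ⊤) :
    (-csiszarTerm ρ a b).toENNReal + b = a ^ (1 + ρ) * b ^ (-ρ) + (csiszarTerm ρ a b).toENNReal ∧
      (csiszarTerm ρ a b).toENNReal ≤ b := by
  rcases eq_or_ne b 0 with rfl | hb0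
  · simp [csiszarTerm, hρ, hρ.not_gt]
  · obtain ⟨t, B, ht, hB, h1, h2, h3⟩ := csiszarTerm_of_ne_zero ha hb hb0 hρ1
    rw [h2, h3, h1, Real.sign_of_neg hρ, ← EReal.coe_neg, neg_one_mul, neg_neg, neg_sub]
    simp only [EReal.real_coe_toENNReal]
    exact ⟨ofReal_sub_add_ofReal ht hB, ENNReal.ofReal_le_ofReal (by linarith)⟩

/-- Used with `b` the escort density of `R`: its total mass `1` cancels the `+ 1` inside the
logarithm. -/
theorem coe_lintegral_sub_add_one {μ : Measure X} {u v τ b : X → ℝ≥0∞} (hτ : Measurable τ)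
    (hb : Measurable b) (huv : ∀ᵐ x ∂μ, u x + b x = τ x + v x) (hvb : ∀ᵐ x ∂μ, v x ≤ b x)
    (hb1 : ∫⁻ x, b x ∂μ = 1) :
    ((∫⁻ x, u x ∂μ : ℝ≥0∞) : EReal) - ((∫⁻ x, v x ∂μ : ℝ≥0∞) : EReal) + 1
      = ((∫⁻ x, τ x ∂μ : ℝ≥0∞) : EReal) ∧ ∫⁻ x, v x ∂μ ≠ ⊤ := by
  have hv : ∫⁻ x, v x ∂μ ≠ ⊤ :=
    ((lintegral_mono_ae hvb).trans_lt (by rw [hb1]; exact ENNReal.one_lt_top)).ne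
  refine ⟨?_, hv⟩
  have h := lintegral_congr_ae huv
  rw [lintegral_add_right _ hb, lintegral_add_left hτ, hb1] at h
  have h' := congrArg (fun z : ℝ≥0∞ => (z : EReal)) h
  simp only [EReal.coe_ennreal_add, EReal.coe_ennreal_one] at h'
  generalize (∫⁻ x, u x ∂μ) = A at *
  generalize (∫⁻ x, τ x ∂μ) = B at *
  generalize (∫⁻ x, v x ∂μ) = C at *
  lift C to NNReal using hv
  have hc : ((C : ℝ≥0∞) : EReal) = ((C : ℝ) : EReal) := rfl
  rw [hc] at h' ⊢
  rw [sub_eq_add_neg, add_right_comm, h', ← sub_eq_add_neg, EReal.add_sub_cancel_right]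

theorem Admissible.powMass_ne_top {μ : Measure X} {α : ℝ} (hα : 0 < α) {P : Measure X}
    (hP : Admissible μ α P) : powMass μ α P ≠ ⊤ := by
  have := lintegral_rpow_enorm_lt_top_of_eLpNorm_lt_top (by simpa using hα) ENNReal.ofReal_ne_top
    hP.memLp.2
  rw [ENNReal.toReal_ofReal hα.le] at this
  simpa [powMass] using this.ne

theorem rpow_ne_zero_of_ne {x : ℝ≥0∞} (h0 : x ≠ 0) (ht : x ≠ ⊤) {s : ℝ} : x ^ s ≠ 0 :=
  (ENNReal.rpow_pos (pos_iff_ne_zero.2 h0) ht).ne'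

section

variable {μ : Measure X} [SigmaFinite μ] {α : ℝ}

theorem Admissible.powMass_ne_zero (hα : 0 < α) {P : Measure X} (hP : Admissible μ α P) :
    powMass μ α P ≠ 0 := by
  intro h
  have := hP.isProb
  rw [powMass, lintegral_eq_zero_iff ((P.measurable_rnDeriv μ).pow_const α)] at h
  have h0 : P.rnDeriv μ =ᵐ[μ] 0 := by
    filter_upwards [h] with x hx
    simpa [hα, hα.not_gt] using hx
  have h1 := Measure.lintegral_rnDeriv hP.ac
  rw [lintegral_congr_ae h0] at h1
  simp at h1

theorem rnDeriv_escort (P : Measure X) :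
    (escort μ α P).rnDeriv μ =ᵐ[μ] fun x => P.rnDeriv μ x ^ α / powMass μ α P :=
  Measure.rnDeriv_withDensity μ (((P.measurable_rnDeriv μ).pow_const α).div_const _)

theorem crossMass_eq_lintegral {P : Measure X} (hP : Admissible μ α P) (Q : Measure X) :
    crossMass μ α Q P = ∫⁻ x, P.rnDeriv μ x * Q.rnDeriv μ x ^ (α - 1) ∂μ := by
  have := hP.isProb
  exact (lintegral_rnDeriv_mul hP.ac ((Q.measurable_rnDeriv μ).pow_const _).aemeasurable).symm

theorem mul_rpow_sub_one (hα : 0 < α) {x : ℝ≥0∞} (hx : x ≠ ⊤) : x * x ^ (α - 1) = x ^ α := by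
  rcases eq_or_ne x 0 with rfl | h0
  · simp [hα]
  · conv_lhs => rw [← ENNReal.rpow_one x, ← ENNReal.rpow_mul, one_mul]
    rw [← ENNReal.rpow_add _ _ h0 hx]
    congr 1; ring

theorem crossMass_self (hα : 0 < α) {P : Measure X} (hP : Admissible μ α P) :
    crossMass μ α P P = powMass μ α P := by
  have := hP.isProb
  rw [crossMass_eq_lintegral hP, powMass]
  refine lintegral_congr_ae ?_
  filter_upwards [P.rnDeriv_ne_top μ] with x hx
  exact mul_rpow_sub_one hα hx

/-- Since `1 + ρ = α⁻¹` and `-ρ = 1 - α⁻¹`, the escort densities satisfy `a ^ (1 + ρ) * b ^ (-ρ) = p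
* r ^ (α - 1)` up to the normalising constants, and `sgn ρ * I_f + 1` is the integral of this
product. -/
theorem relEntropy_eq (hα : 0 < α) (hα1 : α ≠ 1) {P R : Measure X}
    (hP : Admissible μ α P) (hR : Admissible μ α R) :
    relEntropy μ α P R = (((α⁻¹ - 1)⁻¹ : ℝ) : EReal) *
      ENNReal.log (crossMass μ α R P /
        (powMass μ α P ^ α⁻¹ * powMass μ α R ^ (1 - α⁻¹))) := by
  have := hP.isProb
  have := hR.isProb
  set ρ := α⁻¹ - 1 with hρ
  have hmP := hP.powMass_ne_top hα
  have hmR := hR.powMass_ne_top hα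
  have hmP0 := hP.powMass_ne_zero hα
  have hmR0 := hR.powMass_ne_zero hα
  set a := (escort μ α P).rnDeriv μ with ha
  set b := (escort μ α R).rnDeriv μ with hb
  have hma : Measurable a := Measure.measurable_rnDeriv _ _
  have hmb : Measurable b := Measure.measurable_rnDeriv _ _
  have hatop : ∀ᵐ x ∂μ, a x ≠ ⊤ := by
    filter_upwards [rnDeriv_escort (μ := μ) (α := α) P, P.rnDeriv_ne_top μ] with x h1 h2
    rw [ha, h1]
    exact ENNReal.div_ne_top (ENNReal.rpow_ne_top_of_nonneg hα.le h2) hmP0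
  have hbtop : ∀ᵐ x ∂μ, b x ≠ ⊤ := by
    filter_upwards [rnDeriv_escort (μ := μ) (α := α) R, R.rnDeriv_ne_top μ] with x h1 h2
    rw [hb, h1]
    exact ENNReal.div_ne_top (ENNReal.rpow_ne_top_of_nonneg hα.le h2) hmR0
  have hb1 : ∫⁻ x, b x ∂μ = 1 := by
    rw [lintegral_congr_ae (rnDeriv_escort R)]
    simp only [div_eq_mul_inv]
    rw [lintegral_mul_const _ ((R.measurable_rnDeriv μ).pow_const α)]
    exact ENNReal.mul_inv_cancel hmR0 hmR
  have hτ : ∫⁻ x, a x ^ (1 + ρ) * b x ^ (-ρ) ∂μ = crossMass μ α R P /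
        (powMass μ α P ^ α⁻¹ * powMass μ α R ^ (1 - α⁻¹)) := by
    rw [crossMass_eq_lintegral hP, div_eq_mul_inv, ← lintegral_mul_const' _ _
      (ENNReal.inv_ne_top.2 (mul_ne_zero (rpow_ne_zero_of_ne hmP0 hmP)
        (rpow_ne_zero_of_ne hmR0 hmR)))]
    refine lintegral_congr_ae ?_
    filter_upwards [rnDeriv_escort (μ := μ) (α := α) P, rnDeriv_escort (μ := μ) (α := α) R,
      P.rnDeriv_ne_top μ, R.rnDeriv_ne_top μ] with x h1 h2 h3 h4
    rw [ha, hb, h1, h2, show 1 + ρ = α⁻¹ by rw [hρ]; ring, show -ρ = 1 - α⁻¹ by rw [hρ]; ring,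
      ENNReal.div_rpow_of_nonneg _ _ (inv_pos.2 hα).le, ENNReal.rpow_rpow_inv hα.ne',
      div_eq_mul_inv (_ ^ α), ENNReal.mul_rpow_of_ne_top (ENNReal.rpow_ne_top_of_nonneg hα.le h4)
        (ENNReal.inv_ne_top.2 hmR0), ← ENNReal.rpow_mul, ENNReal.inv_rpow,
      ENNReal.mul_inv (Or.inl (rpow_ne_zero_of_ne hmP0 hmP))
        (Or.inr (rpow_ne_zero_of_ne hmR0 hmR)), show α * (1 - α⁻¹) = α - 1 by field_simp,
      div_eq_mul_inv]
    ring
  have hmτ : Measurable fun x => a x ^ (1 + ρ) * b x ^ (-ρ) :=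
    (hma.pow_const _).mul (hmb.pow_const _)
  have main : ((Real.sign ρ : ℝ) : EReal) * csiszarDiv μ ρ (escort μ α P) (escort μ α R) + 1
      = ((∫⁻ x, a x ^ (1 + ρ) * b x ^ (-ρ) ∂μ : ℝ≥0∞) : EReal) := by
    have hρ1 : -1 < ρ := by have := inv_pos.2 hα; linarith
    have hρ0 : ρ ≠ 0 := by
      intro h
      apply hα1
      have : α⁻¹ = 1 := by linarith
      simpa using congrArg (·⁻¹) this
    rcases lt_or_gt_of_ne hρ0 with h | h
    -- For `ρ < 0` the sign factor exchanges the positive and negative parts; the finite one is then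
    -- the positive part.
    · obtain ⟨h1, h2⟩ := coe_lintegral_sub_add_one (μ := μ) hmτ hmb
        (u := fun x => (-csiszarTerm ρ (a x) (b x)).toENNReal)
        (v := fun x => (csiszarTerm ρ (a x) (b x)).toENNReal)
        (by filter_upwards [hatop, hbtop] with x h1 h2
            exact (toENNReal_csiszarTerm_of_neg h hρ1 h1 h2).1)
        (by filter_upwards [hatop, hbtop] with x h1 h2
            exact (toENNReal_csiszarTerm_of_neg h hρ1 h1 h2).2) hb1
      rw [← h1, csiszarDiv, extIntegral, Real.sign_of_neg h]
      congr 1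
      simp only [EReal.coe_neg, EReal.coe_one, neg_mul, one_mul]
      rw [EReal.neg_sub]
      · rw [add_comm, sub_eq_add_neg]
      · left; exact EReal.coe_ennreal_ne_bot _
      · left; simpa using h2
    · obtain ⟨h1, h2⟩ := coe_lintegral_sub_add_one (μ := μ) hmτ hmb
        (u := fun x => (csiszarTerm ρ (a x) (b x)).toENNReal)
        (v := fun x => (-csiszarTerm ρ (a x) (b x)).toENNReal)
        (by filter_upwards [hatop, hbtop] with x h1 h2
            exact (toENNReal_csiszarTerm_of_pos h h1 h2).1)
        (by filter_upwards [hatop, hbtop] with x h1 h2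
            exact (toENNReal_csiszarTerm_of_pos h h1 h2).2) hb1
      rw [← h1, csiszarDiv, extIntegral, Real.sign_of_pos h]
      simp only [EReal.coe_one, one_mul]
      rfl
  rw [relEntropy, ← hρ, main, EReal.toENNReal_coe, hτ]

end

/-! ### Comparison and finiteness of entropies through power integrals -/

theorem coe_mul_le_coe_mul_iff_of_pos {c : ℝ} (hc : 0 < c) {x y : EReal} :
    (c : EReal) * x ≤ c * y ↔ x ≤ y := by
  have hc' : (0 : EReal) < c := by exact_mod_cast hc
  have key : ∀ z : EReal, ((c⁻¹ : ℝ) : EReal) * (c * z) = z := fun z => by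
    rw [← mul_assoc, ← EReal.coe_mul, inv_mul_cancel₀ hc.ne', EReal.coe_one, one_mul]
  refine ⟨fun h => ?_, fun h => mul_le_mul_of_nonneg_left h hc'.le⟩
  rw [← key x, ← key y]
  exact mul_le_mul_of_nonneg_left h (by exact_mod_cast (inv_pos.2 hc).le)

theorem coe_mul_le_coe_mul_iff_of_neg {c : ℝ} (hc : c < 0) {x y : EReal} :
    (c : EReal) * x ≤ c * y ↔ y ≤ x := by
  have h : ∀ z : EReal, (c : EReal) * z = -(((-c : ℝ) : EReal) * z) := fun z => by
    rw [EReal.coe_neg, neg_mul, neg_neg]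
  rw [h, h, EReal.neg_le_neg_iff, coe_mul_le_coe_mul_iff_of_pos (neg_pos.2 hc)]

theorem coe_mul_lt_top_iff_of_pos {c : ℝ} (hc : 0 < c) {x : EReal} :
    (c : EReal) * x < ⊤ ↔ x < ⊤ := by
  conv_lhs => rw [← EReal.coe_mul_top_of_pos hc]
  rw [← not_le, coe_mul_le_coe_mul_iff_of_pos hc, not_le]

theorem coe_mul_lt_top_iff_of_neg {c : ℝ} (hc : c < 0) {x : EReal} :
    (c : EReal) * x < ⊤ ↔ ⊥ < x := by
  conv_lhs => rw [← EReal.coe_mul_bot_of_neg hc]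
  rw [← not_le, coe_mul_le_coe_mul_iff_of_neg hc, not_le]

theorem isForwardProjection_iff {μ : Measure X} {α : ℝ} {E : Set (Measure X)}
    {R Q : Measure X} (hQ : Q ∈ E) :
    IsForwardProjection μ α E R Q ↔ relEntropy μ α Q R < ⊤ ∧
      ∀ P ∈ E, relEntropy μ α Q R ≤ relEntropy μ α P R := by
  constructor
  · rintro ⟨⟨P, hP, hPfin⟩, -, h⟩
    have hle : ∀ P ∈ E, relEntropy μ α Q R ≤ relEntropy μ α P R :=
      fun P hP => h.le.trans (iInf₂_le P hP)
    exact ⟨(hle P hP).trans_lt hPfin, hle⟩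
  · rintro ⟨h1, h2⟩
    exact ⟨⟨Q, hQ, h1⟩, hQ, le_antisymm (le_iInf₂ h2) (iInf₂_le Q hQ)⟩

/-- Since `0 ^ (α - 1) = ∞` here, a finite integral cannot charge `{q = 0}`. This is the source of
`P(N) = 0`. -/
theorem ae_ne_zero_of_crossMass_ne_top {μ : Measure X} {α : ℝ} (hα1 : α < 1)
    {P Q : Measure X} (h : crossMass μ α Q P ≠ ⊤) : ∀ᵐ x ∂P, Q.rnDeriv μ x ≠ 0 := by
  filter_upwards [ae_lt_top ((Q.measurable_rnDeriv μ).pow_const (α - 1)) h] with x hx h0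
  rw [h0, ENNReal.zero_rpow_of_neg (by linarith)] at hx
  exact lt_irrefl _ hx

section

variable {μ : Measure X} [SigmaFinite μ] {α : ℝ}

theorem div_mul_le_div_mul_iff {a b c d k : ℝ≥0∞} (hc : c ≠ 0) (hc' : c ≠ ⊤) (hd : d ≠ 0)
    (hd' : d ≠ ⊤) (hk : k ≠ 0) (hk' : k ≠ ⊤) :
    a / (c * k) ≤ b / (d * k) ↔ a * d ≤ b * c := by
  rw [ENNReal.div_le_iff (mul_ne_zero hc hk) (ENNReal.mul_ne_top hc' hk'),
    ← ENNReal.mul_div_right_comm,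
    ENNReal.le_div_iff_mul_le (Or.inl (mul_ne_zero hd hk)) (Or.inl (ENNReal.mul_ne_top hd' hk')),
    ← mul_assoc, ← mul_assoc, ENNReal.mul_le_mul_iff_left hk hk']

theorem inv_inv_sub_one_pos (hα : 0 < α) (hα1 : α < 1) : 0 < (α⁻¹ - 1)⁻¹ :=
  inv_pos.2 (sub_pos.2 ((one_lt_inv₀ hα).2 hα1))

theorem inv_inv_sub_one_neg (hα1 : 1 < α) : (α⁻¹ - 1)⁻¹ < 0 :=
  inv_lt_zero.2 (sub_neg.2 (inv_lt_one_of_one_lt₀ hα1))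

theorem relEntropy_le_iff_of_lt_one (hα : 0 < α) (hα1 : α < 1) {P Q R : Measure X}
    (hP : Admissible μ α P) (hQ : Admissible μ α Q) (hR : Admissible μ α R) :
    relEntropy μ α Q R ≤ relEntropy μ α P R ↔
      crossMass μ α R Q * powMass μ α P ^ α⁻¹ ≤ crossMass μ α R P * powMass μ α Q ^ α⁻¹ := by
  have hi : 0 ≤ α⁻¹ := (inv_pos.2 hα).le
  have hmP := hP.powMass_ne_top hα
  have hmQ := hQ.powMass_ne_top hα
  have hmR := hR.powMass_ne_top hα
  have hmP0 := hP.powMass_ne_zero hα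
  have hmQ0 := hQ.powMass_ne_zero hα
  have hmR0 := hR.powMass_ne_zero hα
  rw [relEntropy_eq hα hα1.ne hP hR, relEntropy_eq hα hα1.ne hQ hR,
    coe_mul_le_coe_mul_iff_of_pos (inv_inv_sub_one_pos hα hα1), ENNReal.log_le_log_iff,
    div_mul_le_div_mul_iff (rpow_ne_zero_of_ne hmQ0 hmQ) (ENNReal.rpow_ne_top_of_nonneg hi hmQ)
      (rpow_ne_zero_of_ne hmP0 hmP) (ENNReal.rpow_ne_top_of_nonneg hi hmP)
      (rpow_ne_zero_of_ne hmR0 hmR) (ENNReal.rpow_ne_top_of_ne_zero hmR0 hmR)]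

theorem relEntropy_le_iff_of_one_lt (hα1 : 1 < α) {P Q R : Measure X}
    (hP : Admissible μ α P) (hQ : Admissible μ α Q) (hR : Admissible μ α R) :
    relEntropy μ α Q R ≤ relEntropy μ α P R ↔
      crossMass μ α R P * powMass μ α Q ^ α⁻¹ ≤ crossMass μ α R Q * powMass μ α P ^ α⁻¹ := by
  have hα : 0 < α := by linarith
  have hi : 0 ≤ α⁻¹ := (inv_pos.2 hα).le
  have hmP := hP.powMass_ne_top hα
  have hmQ := hQ.powMass_ne_top hα
  have hmR := hR.powMass_ne_top hα
  have hmP0 := hP.powMass_ne_zero hα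
  have hmQ0 := hQ.powMass_ne_zero hα
  have hmR0 := hR.powMass_ne_zero hα
  rw [relEntropy_eq hα hα1.ne' hP hR, relEntropy_eq hα hα1.ne' hQ hR,
    coe_mul_le_coe_mul_iff_of_neg (inv_inv_sub_one_neg hα1), ENNReal.log_le_log_iff,
    div_mul_le_div_mul_iff (rpow_ne_zero_of_ne hmP0 hmP) (ENNReal.rpow_ne_top_of_nonneg hi hmP)
      (rpow_ne_zero_of_ne hmQ0 hmQ) (ENNReal.rpow_ne_top_of_nonneg hi hmQ)
      (rpow_ne_zero_of_ne hmR0 hmR) (ENNReal.rpow_ne_top_of_ne_zero hmR0 hmR)]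

theorem relEntropy_lt_top_iff_of_lt_one (hα : 0 < α) (hα1 : α < 1) {P R : Measure X}
    (hP : Admissible μ α P) (hR : Admissible μ α R) :
    relEntropy μ α P R < ⊤ ↔ crossMass μ α R P ≠ ⊤ := by
  have hmP := hP.powMass_ne_top hα
  have hmR := hR.powMass_ne_top hα
  have hmP0 := hP.powMass_ne_zero hα
  have hmR0 := hR.powMass_ne_zero hα
  rw [relEntropy_eq hα hα1.ne hP hR, coe_mul_lt_top_iff_of_pos (inv_inv_sub_one_pos hα hα1),
    ENNReal.log_lt_top_iff, lt_top_iff_ne_top, not_iff_not, ENNReal.div_eq_top]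
  have h1 := rpow_ne_zero_of_ne hmP0 hmP (s := α⁻¹)
  have h2 := rpow_ne_zero_of_ne hmR0 hmR (s := 1 - α⁻¹)
  have h3 := ENNReal.mul_ne_top (ENNReal.rpow_ne_top_of_ne_zero hmP0 hmP (y := α⁻¹))
    (ENNReal.rpow_ne_top_of_ne_zero hmR0 hmR (y := 1 - α⁻¹))
  simp only [mul_eq_zero, h1, h2, h3, or_self, and_false, false_or, ne_eq, not_false_eq_true,
    and_true]

theorem relEntropy_lt_top_iff_of_one_lt (hα1 : 1 < α) {P R : Measure X}
    (hP : Admissible μ α P) (hR : Admissible μ α R) :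
    relEntropy μ α P R < ⊤ ↔ crossMass μ α R P ≠ 0 := by
  have hα : 0 < α := by linarith
  have hmP := hP.powMass_ne_top hα
  have hmR := hR.powMass_ne_top hα
  have hmP0 := hP.powMass_ne_zero hα
  have hmR0 := hR.powMass_ne_zero hα
  rw [relEntropy_eq hα hα1.ne' hP hR, coe_mul_lt_top_iff_of_neg (inv_inv_sub_one_neg hα1),
    ENNReal.bot_lt_log_iff, pos_iff_ne_zero, not_iff_not, ENNReal.div_eq_zero_iff]
  have h3 := ENNReal.mul_ne_top (ENNReal.rpow_ne_top_of_ne_zero hmP0 hmP (y := α⁻¹))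
    (ENNReal.rpow_ne_top_of_ne_zero hmR0 hmR (y := 1 - α⁻¹))
  simp only [h3, or_false]

/-! ### Hölder's inequality and its reverse -/

/-- Hölder's inequality for `∫ q ^ (α - 1) dP`. -/
theorem crossMass_le (hα1 : 1 < α) {P : Measure X} (hP : Admissible μ α P) (Q : Measure X) :
    crossMass μ α Q P ≤ powMass μ α P ^ α⁻¹ * powMass μ α Q ^ (1 - α⁻¹) := by
  have hα : 0 < α := by linarith
  have hc : α.HolderConjugate (α / (α - 1)) := Real.HolderConjugate.conjExponent hα1
  rw [crossMass_eq_lintegral hP]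
  refine (ENNReal.lintegral_mul_le_Lp_mul_Lq μ hc (P.measurable_rnDeriv μ).aemeasurable
    ((Q.measurable_rnDeriv μ).pow_const (α - 1)).aemeasurable).trans_eq ?_
  have h1 : 1 / (α / (α - 1)) = 1 - α⁻¹ := by field_simp
  have h2 : (α - 1) * (α / (α - 1)) = α := by
    have : α - 1 ≠ 0 := by linarith
    field_simp
  simp only [← ENNReal.rpow_mul]
  rw [h1, h2, one_div]
  rfl

theorem Admissible.crossMass_ne_top (hα1 : 1 < α) {P Q : Measure X} (hP : Admissible μ α P)
    (hQ : Admissible μ α Q) : crossMass μ α Q P ≠ ⊤ := by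
  have hα : 0 < α := by linarith
  refine ((crossMass_le hα1 hP Q).trans_lt (ENNReal.mul_lt_top ?_ ?_)).ne
  · exact (ENNReal.rpow_ne_top_of_ne_zero (hP.powMass_ne_zero hα) (hP.powMass_ne_top hα)).lt_top
  · exact (ENNReal.rpow_ne_top_of_ne_zero (hQ.powMass_ne_zero hα) (hQ.powMass_ne_top hα)).lt_top

/-- The reverse Hölder inequality for `∫ q ^ (α - 1) dP`. -/
theorem le_crossMass (hα : 0 < α) (hα1 : α < 1) {P Q : Measure X} (hP : Admissible μ α P)
    (hQ : Admissible μ α Q) :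
    powMass μ α P ^ α⁻¹ * powMass μ α Q ^ (1 - α⁻¹) ≤ crossMass μ α Q P := by
  have := hP.isProb
  have := hQ.isProb
  rcases eq_or_ne (crossMass μ α Q P) ⊤ with htop | htop
  · rw [htop]; exact le_top
  have hmQ := hQ.powMass_ne_top hα
  have hmQ0 := hQ.powMass_ne_zero hα
  have h0 : ∀ᵐ x ∂μ, P.rnDeriv μ x ≠ 0 → Q.rnDeriv μ x ≠ 0 := by
    have := ae_ne_zero_of_crossMass_ne_top hα1 htop
    rw [← Measure.withDensity_rnDeriv_eq P μ hP.ac,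
      ae_withDensity_iff (P.measurable_rnDeriv μ)] at this
    exact this
  have hc : (α⁻¹).HolderConjugate ((1 - α)⁻¹) := by
    rw [Real.holderConjugate_iff]
    exact ⟨(one_lt_inv₀ hα).2 hα1, by simp⟩
  -- Ordinary Hölder with exponents `1/α` and `1/(1 - α)` for the factorisation `p ^ α = (p q ^ (α -
  -- 1)) ^ α * (q ^ α) ^ (1 - α)`, valid because `q > 0` wherever `p > 0`, up to a `μ`-null set.
  have hH : powMass μ α P ≤ crossMass μ α Q P ^ α * powMass μ α Q ^ (1 - α) := by
    have := ENNReal.lintegral_mul_le_Lp_mul_Lq μ hc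
      (((P.measurable_rnDeriv μ).mul ((Q.measurable_rnDeriv μ).pow_const (α - 1))).pow_const
        α).aemeasurable
      (((Q.measurable_rnDeriv μ).pow_const α).pow_const (1 - α)).aemeasurable
    simp only [one_div, inv_inv, ENNReal.rpow_rpow_inv hα.ne',
      ENNReal.rpow_rpow_inv (sub_pos.2 hα1).ne'] at this
    rw [crossMass_eq_lintegral hP]
    refine le_trans (le_of_eq ?_) this
    refine lintegral_congr_ae ?_
    filter_upwards [h0, P.rnDeriv_ne_top μ, Q.rnDeriv_ne_top μ] with x hx h1 h2
    simp only [Pi.mul_apply]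
    rcases eq_or_ne (P.rnDeriv μ x) 0 with hp | hp
    · simp [hp, hα]
    · rw [ENNReal.mul_rpow_of_nonneg _ _ hα.le, ← ENNReal.rpow_mul, ← ENNReal.rpow_mul, mul_assoc,
        ← ENNReal.rpow_add _ _ (hx hp) h2, show (α - 1) * α + α * (1 - α) = 0 by ring,
        ENNReal.rpow_zero, mul_one]
  calc powMass μ α P ^ α⁻¹ * powMass μ α Q ^ (1 - α⁻¹)
      ≤ (crossMass μ α Q P ^ α * powMass μ α Q ^ (1 - α)) ^ α⁻¹ * powMass μ α Q ^ (1 - α⁻¹) := by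
        gcongr
    _ = crossMass μ α Q P := by
        rw [ENNReal.mul_rpow_of_nonneg _ _ (inv_pos.2 hα).le, ENNReal.rpow_rpow_inv hα.ne',
          ← ENNReal.rpow_mul, mul_assoc, ← ENNReal.rpow_add _ _ hmQ0 hmQ,
          show (1 - α) * α⁻¹ + (1 - α⁻¹) = 0 by field_simp; ring, ENNReal.rpow_zero, mul_one]

end

/-! ### One-sided derivatives of `∫ p ^ α` along chords -/

theorem tendsto_rpow_chord {α p q : ℝ} (h : q ≠ 0 ∨ 1 ≤ α) :
    Tendsto (fun t : ℝ => (((1 - t) * q + t * p) ^ α - q ^ α) / t) (𝓝[>] 0)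
      (𝓝 (α * q ^ (α - 1) * (p - q))) := by
  have h1 : HasDerivAt (fun t : ℝ => (1 - t) * q + t * p) (p - q) 0 := by
    have := (((hasDerivAt_id (0 : ℝ)).const_sub 1).mul_const q).add
      ((hasDerivAt_id (0 : ℝ)).mul_const p)
    convert! this using 1
    ring
  have h2 := h1.rpow_const (p := α) (by simpa using h)
  have h3 := h2.tendsto_slope_zero_right
  simp only [sub_zero, one_mul, zero_mul, add_zero, zero_add, smul_eq_mul] at h3
  convert! h3 using 2
  · rw [div_eq_inv_mul]
  · ring

theorem tendsto_rpow_chord_zero {α p : ℝ} (hα1 : α < 1) (hp : 0 < p) :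
    Tendsto (fun t : ℝ => (t * p) ^ α / t) (𝓝[>] 0) atTop := by
  have h := (tendsto_rpow_neg_nhdsGT_zero (sub_neg.2 hα1)).atTop_mul_const
    (Real.rpow_pos_of_pos hp α)
  refine h.congr' ?_
  filter_upwards [self_mem_nhdsWithin] with t ht
  have ht : 0 < t := ht
  rw [Real.mul_rpow ht.le hp.le, Real.rpow_sub ht, Real.rpow_one]
  ring

/-- Passage to the limit in the chord slopes of `∫ p ^ α`, for `α < 1`. -/
theorem lintegral_tangent_le {μ : Measure X} {α : ℝ} (hα : 0 < α) (hα1 : α < 1) {p q : X → ℝ}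
    (hp : Measurable p) (hq : Measurable q) (hp0 : ∀ x, 0 ≤ p x) (hq0 : ∀ x, 0 ≤ q x) {K : ℝ≥0∞}
    (hK : ∀ t : ℝ, 0 < t → t < 1 →
      ∫⁻ x, ENNReal.ofReal ((((1 - t) * q x + t * p x) ^ α - q x ^ α) / t + q x ^ α) ∂μ ≤ K) :
    ∫⁻ x, (ENNReal.ofReal α * (ENNReal.ofReal (p x) * ENNReal.ofReal (q x) ^ (α - 1))
      + ENNReal.ofReal (1 - α) * ENNReal.ofReal (q x) ^ α) ∂μ ≤ K := by
  -- Fatou's lemma, so no domination is needed. The limit is infinite where `q = 0 < p`, and this is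
  -- what later excludes mass of `P` on `{q = 0}`.
  have hF := lintegral_liminf_le (μ := μ) (u := 𝓝[>] (0 : ℝ))
    (f := fun t x => ENNReal.ofReal ((((1 - t) * q x + t * p x) ^ α - q x ^ α) / t + q x ^ α))
    (fun t => by fun_prop)
  refine le_trans (le_of_eq ?_) (hF.trans ?_)
  · refine lintegral_congr fun x => ?_
    symm
    refine Tendsto.liminf_eq ?_
    rcases (hq0 x).eq_or_lt with h0 | h0
    · simp only [← h0, mul_zero, zero_add, Real.zero_rpow hα.ne', sub_zero, add_zero,
        ENNReal.ofReal_zero, ENNReal.zero_rpow_of_pos hα]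
      rcases (hp0 x).eq_or_lt with h1 | h1
      · simp [← h1, Real.zero_rpow hα.ne']
      · rw [ENNReal.zero_rpow_of_neg (by linarith), ENNReal.mul_top (by simpa using h1),
          ENNReal.mul_top (by simpa using hα)]
        exact ENNReal.tendsto_ofReal_atTop.comp (tendsto_rpow_chord_zero hα1 h1)
    · have h2 := ENNReal.tendsto_ofReal
        ((tendsto_rpow_chord (α := α) (p := p x) (Or.inl h0.ne')).add_const (q x ^ α))
      convert! h2 using 2
      rw [ENNReal.ofReal_rpow_of_pos h0, ENNReal.ofReal_rpow_of_pos h0,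
        ← ENNReal.ofReal_mul (hp0 x), ← ENNReal.ofReal_mul hα.le,
        ← ENNReal.ofReal_mul (by linarith), ← ENNReal.ofReal_add]
      · congr 1
        have : q x ^ α = q x ^ (α - 1) * q x := by
          rw [Real.rpow_sub_one h0.ne', div_mul_cancel₀ _ h0.ne']
        rw [this]; ring
      · have := hp0 x; positivity
      · have : 0 < 1 - α := by linarith
        positivity
  · refine (liminf_le_liminf (v := fun _ => K) ?_).trans_eq ?_
    · filter_upwards [Ioo_mem_nhdsGT (zero_lt_one (α := ℝ))] with t ht
      exact hK t ht.1 ht.2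
    · simp

/-- Passage to the limit in the chord slopes of `∫ p ^ α`, for `α > 1`. -/
theorem le_integral_tangent {μ : Measure X} {α : ℝ} (hα1 : 1 < α) {p q : X → ℝ}
    (hp : Measurable p) (hq : Measurable q) (hp0 : ∀ x, 0 ≤ p x) (hq0 : ∀ x, 0 ≤ q x)
    (hpi : Integrable (fun x => p x ^ α) μ) (hqi : Integrable (fun x => q x ^ α) μ) {K : ℝ}
    (hK : ∀ t : ℝ, 0 < t → t < 1 →
      K ≤ ∫ x, (((1 - t) * q x + t * p x) ^ α - q x ^ α) / t ∂μ) :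
    K ≤ ∫ x, α * q x ^ (α - 1) * (p x - q x) ∂μ := by
  have hα : 0 < α := by linarith
  have hT : Tendsto (fun t : ℝ => ∫ x, (((1 - t) * q x + t * p x) ^ α - q x ^ α) / t ∂μ)
      (𝓝[>] 0) (𝓝 (∫ x, α * q x ^ (α - 1) * (p x - q x) ∂μ)) := by
    -- The slopes lie between `-α q ^ α` (Bernoulli, after dropping `t p`) and `p ^ α - q ^ α`
    -- (convexity), which gives the dominating function.
    refine tendsto_integral_filter_of_dominated_convergence
      (fun x => α * q x ^ α + p x ^ α) ?_ ?_ ((hqi.const_mul α).add hpi) ?_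
    · exact Eventually.of_forall fun t => Measurable.aestronglyMeasurable (by fun_prop)
    · filter_upwards [Ioo_mem_nhdsGT (zero_lt_one (α := ℝ))] with t ht
      refine ae_of_all _ fun x => ?_
      have ht0 := ht.1
      have h1t : 0 < 1 - t := by linarith [ht.2]
      have hqx := hq0 x
      have hpx := hp0 x
      have hqa : 0 ≤ q x ^ α := by positivity
      have hpa : 0 ≤ p x ^ α := by positivity
      rw [Real.norm_eq_abs, abs_le]
      constructor
      · rw [le_div_iff₀ ht0]
        have hb := one_add_mul_self_le_rpow_one_add (s := -t) (by linarith [ht.2]) hα1.le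
        have h2 : ((1 - t) * q x) ^ α ≤ ((1 - t) * q x + t * p x) ^ α := by
          gcongr
          have : 0 ≤ t * p x := by positivity
          linarith
        rw [Real.mul_rpow h1t.le hqx] at h2
        have h3 := mul_le_mul_of_nonneg_right hb hqa
        rw [← sub_eq_add_neg] at h3
        nlinarith [mul_nonneg ht0.le hpa]
      · rw [div_le_iff₀ ht0]
        have hc := (convexOn_rpow hα1.le).2 (x := q x) hqx (y := p x) hpx h1t.le ht0.le (by ring)
        simp only [smul_eq_mul] at hc
        nlinarith [mul_nonneg ht0.le hqa, mul_nonneg (mul_nonneg ht0.le hα.le) hqa]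
    · exact ae_of_all _ fun x => tendsto_rpow_chord (Or.inr hα1.le)
  refine ge_of_tendsto hT ?_
  filter_upwards [Ioo_mem_nhdsGT (zero_lt_one (α := ℝ))] with t ht
  exact hK t ht.1 ht.2

/-- Dividing `h` by `a` gives `Mt ^ α⁻¹ ≤ (1 + s) M ^ α⁻¹` with `s = t (b / a - 1)`; raise to the
power `α` and apply Bernoulli's inequality `(1 + s) ^ α ≤ 1 + α s`. For `α > 1` every inequality is
reversed. -/
theorem rpow_chord_bound_of_lt_one {α a b M Mt t : ℝ} (hα : 0 < α) (hα1 : α < 1) (ha : 0 < a)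
    (hb : 0 ≤ b) (hM : 0 ≤ M) (hMt : 0 ≤ Mt) (ht : 0 < t) (ht1 : t < 1)
    (h : a * Mt ^ α⁻¹ ≤ ((1 - t) * a + t * b) * M ^ α⁻¹) :
    (Mt - M) / t ≤ α * (b / a - 1) * M := by
  have hs : -1 ≤ t * (b / a - 1) := by
    have : 0 ≤ b / a := by positivity
    nlinarith
  have h1 : Mt ^ α⁻¹ ≤ (1 + t * (b / a - 1)) * M ^ α⁻¹ := by
    have : (1 + t * (b / a - 1)) * M ^ α⁻¹ = ((1 - t) * a + t * b) * M ^ α⁻¹ / a := by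
      field_simp; ring
    rw [this, le_div_iff₀ ha]
    linarith
  have h2 := Real.rpow_le_rpow (by positivity) h1 hα.le
  rw [Real.rpow_inv_rpow hMt hα.ne', Real.mul_rpow (by linarith) (by positivity),
    Real.rpow_inv_rpow hM hα.ne'] at h2
  have h3 := mul_le_mul_of_nonneg_right (rpow_one_add_le_one_add_mul_self hs hα.le hα1.le) hM
  rw [div_le_iff₀ ht]
  linarith

theorem rpow_chord_bound_of_one_lt {α a b M Mt t : ℝ} (hα1 : 1 < α) (ha : 0 < a)
    (hb : 0 ≤ b) (hM : 0 ≤ M) (hMt : 0 ≤ Mt) (ht : 0 < t) (ht1 : t < 1)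
    (h : ((1 - t) * a + t * b) * M ^ α⁻¹ ≤ a * Mt ^ α⁻¹) :
    α * (b / a - 1) * M ≤ (Mt - M) / t := by
  have hα : 0 < α := by linarith
  have hs : -1 ≤ t * (b / a - 1) := by
    have : 0 ≤ b / a := by positivity
    nlinarith
  have h1 : (1 + t * (b / a - 1)) * M ^ α⁻¹ ≤ Mt ^ α⁻¹ := by
    have : (1 + t * (b / a - 1)) * M ^ α⁻¹ = ((1 - t) * a + t * b) * M ^ α⁻¹ / a := by
      field_simp; ring
    rw [this, div_le_iff₀ ha]
    linarith
  have h2 := Real.rpow_le_rpow (mul_nonneg (by linarith) (by positivity)) h1 hα.le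
  rw [Real.rpow_inv_rpow hMt hα.ne', Real.mul_rpow (by linarith) (by positivity),
    Real.rpow_inv_rpow hM hα.ne'] at h2
  have h3 := mul_le_mul_of_nonneg_right (one_add_mul_self_le_rpow_one_add hs hα1.le) hM
  rw [le_div_iff₀ ht]
  linarith

/-! ### Mixtures inside the linear family -/

/-- The mixture `(1 - t) Q + t P`. -/
noncomputable def mix (t : ℝ) (Q P : Measure X) : Measure X :=
  ENNReal.ofReal (1 - t) • Q + ENNReal.ofReal t • P

theorem isProbabilityMeasure_mix {t : ℝ} (ht : 0 < t) (ht1 : t < 1) (Q P : Measure X)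
    [IsProbabilityMeasure Q] [IsProbabilityMeasure P] : IsProbabilityMeasure (mix t Q P) := by
  constructor
  simp only [mix, Measure.coe_add, Measure.coe_smul, Pi.add_apply, Pi.smul_apply, measure_univ,
    smul_eq_mul, mul_one]
  rw [← ENNReal.ofReal_add (by linarith) ht.le]
  simp

theorem toReal_crossMass_mix {μ : Measure X} {α t : ℝ} (ht : 0 < t) (ht1 : t < 1)
    {Q P R : Measure X} (hQ : crossMass μ α R Q ≠ ⊤) (hP : crossMass μ α R P ≠ ⊤) :
    (crossMass μ α R (mix t Q P)).toReal
      = (1 - t) * (crossMass μ α R Q).toReal + t * (crossMass μ α R P).toReal := by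
  have : crossMass μ α R (mix t Q P)
      = ENNReal.ofReal (1 - t) * crossMass μ α R Q + ENNReal.ofReal t * crossMass μ α R P := by
    simp only [crossMass, mix]
    rw [lintegral_add_measure, lintegral_smul_measure, lintegral_smul_measure]
    rfl
  rw [this, ENNReal.toReal_add (ENNReal.mul_ne_top ENNReal.ofReal_ne_top hQ)
    (ENNReal.mul_ne_top ENNReal.ofReal_ne_top hP), ENNReal.toReal_mul, ENNReal.toReal_mul,
    ENNReal.toReal_ofReal (by linarith), ENNReal.toReal_ofReal ht.le]

section

variable {μ : Measure X} {α : ℝ}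

theorem toReal_powMass (hα : 0 < α) (P : Measure X) [IsProbabilityMeasure P] :
    (powMass μ α P).toReal = ∫ x, (P.rnDeriv μ x).toReal ^ α ∂μ := by
  rw [powMass, ← integral_toReal ((P.measurable_rnDeriv μ).pow_const α).aemeasurable]
  · simp only [ENNReal.toReal_rpow]
  · filter_upwards [P.rnDeriv_ne_top μ] with x hx
    exact (ENNReal.rpow_ne_top_of_nonneg hα.le hx).lt_top

theorem Admissible.integrable_rpow (hα : 0 < α) {P : Measure X} (hP : Admissible μ α P) :
    Integrable (fun x => (P.rnDeriv μ x).toReal ^ α) μ := by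
  simp only [ENNReal.toReal_rpow]
  exact integrable_toReal_of_lintegral_ne_top
    ((P.measurable_rnDeriv μ).pow_const α).aemeasurable (hP.powMass_ne_top hα)

theorem admissible_of_integrable_rpow (hα : 0 < α) {P : Measure X} (hP : IsProbabilityMeasure P)
    (hac : P ≪ μ) (hi : Integrable (fun x => (P.rnDeriv μ x).toReal ^ α) μ) :
    Admissible μ α P := by
  refine ⟨hP, hac, (P.measurable_rnDeriv μ).aestronglyMeasurable, ?_⟩
  rw [eLpNorm_lt_top_iff_lintegral_rpow_enorm_lt_top (by simpa using hα) ENNReal.ofReal_ne_top,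
    ENNReal.toReal_ofReal hα.le]
  refine lt_of_le_of_lt (le_of_eq ?_) hi.lintegral_lt_top
  refine lintegral_congr_ae ?_
  filter_upwards [P.rnDeriv_ne_top μ] with x hx
  rw [ENNReal.toReal_rpow, ENNReal.ofReal_toReal (ENNReal.rpow_ne_top_of_nonneg hα.le hx)]
  rfl

theorem integrable_rpow_mix (hα : 0 < α) {t : ℝ} (ht : 0 < t) (ht1 : t < 1) {p q : X → ℝ}
    (hp : Measurable p) (hq : Measurable q) (hp0 : ∀ x, 0 ≤ p x) (hq0 : ∀ x, 0 ≤ q x)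
    (hpi : Integrable (fun x => p x ^ α) μ) (hqi : Integrable (fun x => q x ^ α) μ) :
    Integrable (fun x => ((1 - t) * q x + t * p x) ^ α) μ := by
  refine (hpi.add hqi).mono' (Measurable.aestronglyMeasurable (by fun_prop))
    (ae_of_all _ fun x => ?_)
  have h1t : 0 < 1 - t := by linarith
  have hqx := hq0 x
  have hpx := hp0 x
  have hqa : 0 ≤ q x ^ α := by positivity
  have hpa : 0 ≤ p x ^ α := by positivity
  rw [Real.norm_of_nonneg (by positivity), Pi.add_apply]
  have hmax : (1 - t) * q x + t * p x ≤ max (p x) (q x) := by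
    nlinarith [le_max_left (p x) (q x), le_max_right (p x) (q x)]
  refine (Real.rpow_le_rpow (by positivity) hmax hα.le).trans ?_
  rcases max_choice (p x) (q x) with h | h <;> rw [h] <;> linarith

variable [SigmaFinite μ]

theorem toReal_rnDeriv_mix {t : ℝ} (ht : 0 < t) (ht1 : t < 1) (Q P : Measure X)
    [IsProbabilityMeasure Q] [IsProbabilityMeasure P] :
    ∀ᵐ x ∂μ, ((mix t Q P).rnDeriv μ x).toReal
      = (1 - t) * (Q.rnDeriv μ x).toReal + t * (P.rnDeriv μ x).toReal := by
  have hf1 : IsFiniteMeasure (ENNReal.ofReal (1 - t) • Q) :=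
    Measure.smul_finite Q ENNReal.ofReal_ne_top
  have hf2 : IsFiniteMeasure (ENNReal.ofReal t • P) := Measure.smul_finite P ENNReal.ofReal_ne_top
  filter_upwards [Measure.rnDeriv_add' (ENNReal.ofReal (1 - t) • Q) (ENNReal.ofReal t • P) μ,
    Measure.rnDeriv_smul_left_of_ne_top' Q μ (ENNReal.ofReal_ne_top (r := 1 - t)),
    Measure.rnDeriv_smul_left_of_ne_top' P μ (ENNReal.ofReal_ne_top (r := t)),
    Q.rnDeriv_ne_top μ, P.rnDeriv_ne_top μ] with x h1 h2 h3 h4 h5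
  rw [mix, h1, Pi.add_apply, h2, h3, Pi.smul_apply, Pi.smul_apply, smul_eq_mul, smul_eq_mul,
    ENNReal.toReal_add (ENNReal.mul_ne_top ENNReal.ofReal_ne_top h4)
      (ENNReal.mul_ne_top ENNReal.ofReal_ne_top h5), ENNReal.toReal_mul, ENNReal.toReal_mul,
    ENNReal.toReal_ofReal (by linarith), ENNReal.toReal_ofReal ht.le]

theorem mix_mem_linearFamily (hα : 0 < α) {Γ : Type*} {f : Γ → X → ℝ} {t : ℝ} (ht : 0 < t)
    (ht1 : t < 1) {Q P : Measure X} (hQ : Q ∈ linearFamily μ α f) (hP : P ∈ linearFamily μ α f) :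
    mix t Q P ∈ linearFamily μ α f := by
  have := hQ.1.isProb
  have := hP.1.isProb
  refine ⟨admissible_of_integrable_rpow hα (isProbabilityMeasure_mix ht ht1 Q P) ?_ ?_, ?_⟩
  · exact (hQ.1.ac.smul_left _).add_left (hP.1.ac.smul_left _)
  · refine (integrable_rpow_mix hα ht ht1 (P.measurable_rnDeriv μ).ennreal_toReal
      (Q.measurable_rnDeriv μ).ennreal_toReal (fun _ => ENNReal.toReal_nonneg)
      (fun _ => ENNReal.toReal_nonneg) (hP.1.integrable_rpow hα)
      (hQ.1.integrable_rpow hα)).congr ?_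
    filter_upwards [toReal_rnDeriv_mix (μ := μ) ht ht1 Q P] with x hx
    rw [hx]
  · intro γ
    have h1 := (hQ.2 γ).1.smul_measure (ENNReal.ofReal_ne_top (r := 1 - t))
    have h2 := (hP.2 γ).1.smul_measure (ENNReal.ofReal_ne_top (r := t))
    refine ⟨h1.add_measure h2, ?_⟩
    rw [mix, integral_add_measure h1 h2, integral_smul_measure, integral_smul_measure,
      (hQ.2 γ).2, (hP.2 γ).2]
    simp

theorem integral_chord (hα : 0 < α) {Γ : Type*} {f : Γ → X → ℝ} {t : ℝ} (ht : 0 < t)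
    (ht1 : t < 1) {Q P : Measure X} (hQ : Q ∈ linearFamily μ α f) (hP : P ∈ linearFamily μ α f) :
    Integrable (fun x => ((1 - t) * (Q.rnDeriv μ x).toReal + t * (P.rnDeriv μ x).toReal) ^ α) μ ∧
    ∫ x, (((1 - t) * (Q.rnDeriv μ x).toReal + t * (P.rnDeriv μ x).toReal) ^ α
        - (Q.rnDeriv μ x).toReal ^ α) / t ∂μ
      = ((powMass μ α (mix t Q P)).toReal - (powMass μ α Q).toReal) / t := by
  have := hQ.1.isProb
  have := hP.1.isProb
  have := isProbabilityMeasure_mix ht ht1 Q P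
  have hi := integrable_rpow_mix hα ht ht1 (P.measurable_rnDeriv μ).ennreal_toReal
      (Q.measurable_rnDeriv μ).ennreal_toReal (fun _ => ENNReal.toReal_nonneg)
      (fun _ => ENNReal.toReal_nonneg) (hP.1.integrable_rpow hα) (hQ.1.integrable_rpow hα)
  refine ⟨hi, ?_⟩
  rw [integral_div, integral_sub hi (hQ.1.integrable_rpow hα), toReal_powMass hα,
    toReal_powMass hα]
  congr 2
  refine integral_congr_ae ?_
  filter_upwards [toReal_rnDeriv_mix (μ := μ) ht ht1 Q P] with x hx
  rw [hx]

end

/-! ### First-order conditions at a projection -/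

section

variable {μ : Measure X} {α : ℝ}

theorem integrable_rpow_of_crossMass_ne_top {Z P : Measure X} (h : crossMass μ α Z P ≠ ⊤) :
    Integrable (fun x => (Z.rnDeriv μ x).toReal ^ (α - 1)) P := by
  simp only [ENNReal.toReal_rpow]
  exact integrable_toReal_of_lintegral_ne_top
    ((Z.measurable_rnDeriv μ).pow_const (α - 1)).aemeasurable h

theorem toReal_crossMass {Z P : Measure X}
    (h : ∀ᵐ x ∂P, Z.rnDeriv μ x ^ (α - 1) ≠ ⊤) :
    (crossMass μ α Z P).toReal = ∫ x, (Z.rnDeriv μ x).toReal ^ (α - 1) ∂P := by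
  rw [crossMass, ← integral_toReal ((Z.measurable_rnDeriv μ).pow_const (α - 1)).aemeasurable]
  · simp only [ENNReal.toReal_rpow]
  · filter_upwards [h] with x hx using hx.lt_top

theorem ae_rpow_ne_top_of_crossMass_ne_top {Z P : Measure X} (h : crossMass μ α Z P ≠ ⊤) :
    ∀ᵐ x ∂P, Z.rnDeriv μ x ^ (α - 1) ≠ ⊤ := by
  filter_upwards [ae_lt_top ((Z.measurable_rnDeriv μ).pow_const (α - 1)) h] with x hx using hx.ne

theorem crossMass_ne_top_of_integrable {Z P : Measure X}
    (h : ∀ᵐ x ∂P, Z.rnDeriv μ x ^ (α - 1) ≠ ⊤)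
    (hi : Integrable (fun x => (Z.rnDeriv μ x).toReal ^ (α - 1)) P) : crossMass μ α Z P ≠ ⊤ := by
  refine (lt_of_le_of_lt (le_of_eq ?_) hi.lintegral_lt_top).ne
  refine lintegral_congr_ae ?_
  filter_upwards [h] with x hx
  rw [ENNReal.toReal_rpow, ENNReal.ofReal_toReal hx]

variable [SigmaFinite μ]

theorem crossMass_ne_zero_of_lt_one (hα : 0 < α) (hα1 : α < 1) {P Q : Measure X}
    (hP : Admissible μ α P) (hQ : Admissible μ α Q) : crossMass μ α Q P ≠ 0 := by
  refine (lt_of_lt_of_le ?_ (le_crossMass hα hα1 hP hQ)).ne'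
  exact pos_iff_ne_zero.2 (mul_ne_zero
    (rpow_ne_zero_of_ne (hP.powMass_ne_zero hα) (hP.powMass_ne_top hα))
    (rpow_ne_zero_of_ne (hQ.powMass_ne_zero hα) (hQ.powMass_ne_top hα)))

/-- First-order condition at a projection, for `α < 1`. -/
theorem crossMass_variation_of_lt_one (hα : 0 < α) (hα1 : α < 1) {Γ : Type*} {f : Γ → X → ℝ}
    {P Q R : Measure X} (hR : Admissible μ α R) (hQ : Q ∈ linearFamily μ α f)
    (hP : P ∈ linearFamily μ α f) (hQt : crossMass μ α R Q ≠ ⊤) (hPt : crossMass μ α R P ≠ ⊤)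
    (hopt : ∀ P ∈ linearFamily μ α f, relEntropy μ α Q R ≤ relEntropy μ α P R) :
    crossMass μ α Q P ≠ ⊤ ∧ (crossMass μ α R Q).toReal * (crossMass μ α Q P).toReal
      ≤ (powMass μ α Q).toReal * (crossMass μ α R P).toReal := by
  have := hQ.1.isProb
  have := hP.1.isProb
  have hmQ := hQ.1.powMass_ne_top hα
  set a := (crossMass μ α R Q).toReal with ha
  set b := (crossMass μ α R P).toReal with hb
  set M := (powMass μ α Q).toReal with hM
  have ha0 : 0 < a := ENNReal.toReal_pos (crossMass_ne_zero_of_lt_one hα hα1 hQ.1 hR) hQt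
  have hb0 : 0 ≤ b := ENNReal.toReal_nonneg
  have hM0 : 0 ≤ M := ENNReal.toReal_nonneg
  have key := lintegral_tangent_le (μ := μ) (K := ENNReal.ofReal (α * (b / a - 1) * M + M)) hα hα1
    (P.measurable_rnDeriv μ).ennreal_toReal (Q.measurable_rnDeriv μ).ennreal_toReal
    (fun _ => ENNReal.toReal_nonneg) (fun _ => ENNReal.toReal_nonneg) (by
      intro t ht ht1
      obtain ⟨hi, hint⟩ := integral_chord hα ht ht1 hQ hP
      have hqi := hQ.1.integrable_rpow hα
      have hmix := mix_mem_linearFamily hα ht ht1 hQ hP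
      have h1 := (relEntropy_le_iff_of_lt_one hα hα1 hmix.1 hQ.1 hR).1 (hopt _ hmix)
      have hSt : crossMass μ α R (mix t Q P) ≠ ⊤ := by
        simp only [crossMass, mix]
        rw [lintegral_add_measure, lintegral_smul_measure, lintegral_smul_measure]
        exact ENNReal.add_ne_top.2 ⟨ENNReal.mul_ne_top ENNReal.ofReal_ne_top hQt,
          ENNReal.mul_ne_top ENNReal.ofReal_ne_top hPt⟩
      have h2 := ENNReal.toReal_mono (ENNReal.mul_ne_top hSt
        (ENNReal.rpow_ne_top_of_nonneg (inv_pos.2 hα).le hmQ)) h1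
      rw [ENNReal.toReal_mul, ENNReal.toReal_mul, ← ENNReal.toReal_rpow, ← ENNReal.toReal_rpow,
        toReal_crossMass_mix ht ht1 hQt hPt] at h2
      have h3 := rpow_chord_bound_of_lt_one hα hα1 ha0 hb0 hM0 ENNReal.toReal_nonneg ht ht1 h2
      have hci : Integrable (fun x =>
          (((1 - t) * (Q.rnDeriv μ x).toReal + t * (P.rnDeriv μ x).toReal) ^ α
            - (Q.rnDeriv μ x).toReal ^ α) / t) μ := (hi.sub hqi).div_const t
      have hsi : Integrable (fun x =>
          (((1 - t) * (Q.rnDeriv μ x).toReal + t * (P.rnDeriv μ x).toReal) ^ α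
            - (Q.rnDeriv μ x).toReal ^ α) / t + (Q.rnDeriv μ x).toReal ^ α) μ := hci.add hqi
      rw [← ofReal_integral_eq_lintegral_ofReal hsi]
      · refine ENNReal.ofReal_le_ofReal ?_
        rw [integral_add hci hqi, hint, ← toReal_powMass hα]
        linarith
      · refine ae_of_all _ fun x => ?_
        have hqx : 0 ≤ (Q.rnDeriv μ x).toReal := ENNReal.toReal_nonneg
        have hpx : 0 ≤ (P.rnDeriv μ x).toReal := ENNReal.toReal_nonneg
        have hc := (Real.concaveOn_rpow hα.le hα1.le).2 (x := (Q.rnDeriv μ x).toReal) hqx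
          (y := (P.rnDeriv μ x).toReal) hpx (by linarith : 0 ≤ 1 - t) ht.le (by ring)
        simp only [smul_eq_mul] at hc
        have hpa : 0 ≤ (P.rnDeriv μ x).toReal ^ α := by positivity
        simp only [Pi.zero_apply]
        -- By concavity the slope is at least `p ^ α - q ^ α`; adding `q ^ α` makes the integrand
        -- nonnegative, so its lower integral is the Bochner integral.
        have : -(Q.rnDeriv μ x).toReal ^ α ≤
            (((1 - t) * (Q.rnDeriv μ x).toReal + t * (P.rnDeriv μ x).toReal) ^ α
              - (Q.rnDeriv μ x).toReal ^ α) / t := by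
          rw [le_div_iff₀ ht]
          nlinarith [mul_nonneg ht.le hpa]
        linarith)
  have hL : ∫⁻ x, (ENNReal.ofReal α * (ENNReal.ofReal (P.rnDeriv μ x).toReal *
        ENNReal.ofReal (Q.rnDeriv μ x).toReal ^ (α - 1))
      + ENNReal.ofReal (1 - α) * ENNReal.ofReal (Q.rnDeriv μ x).toReal ^ α) ∂μ
      = ENNReal.ofReal α * crossMass μ α Q P + ENNReal.ofReal (1 - α) * powMass μ α Q := by
    rw [crossMass_eq_lintegral hP.1, powMass, ← lintegral_const_mul' _ _ ENNReal.ofReal_ne_top,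
      ← lintegral_const_mul' _ _ ENNReal.ofReal_ne_top, ← lintegral_add_right _
        (((Q.measurable_rnDeriv μ).pow_const α).const_mul _)]
    refine lintegral_congr_ae ?_
    filter_upwards [P.rnDeriv_ne_top μ, Q.rnDeriv_ne_top μ] with x h1 h2
    rw [ENNReal.ofReal_toReal h1, ENNReal.ofReal_toReal h2]
  rw [hL] at key
  have hU : crossMass μ α Q P ≠ ⊤ := by
    intro h
    rw [h, ENNReal.mul_top (by simpa using hα), top_add] at key
    exact ENNReal.ofReal_ne_top (top_le_iff.1 key)
  refine ⟨hU, ?_⟩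
  have hMt : powMass μ α Q = ENNReal.ofReal M := (ENNReal.ofReal_toReal hmQ).symm
  have hUt : crossMass μ α Q P = ENNReal.ofReal (crossMass μ α Q P).toReal :=
    (ENNReal.ofReal_toReal hU).symm
  have hU0 : 0 ≤ (crossMass μ α Q P).toReal := ENNReal.toReal_nonneg
  have h1α : 0 ≤ 1 - α := by linarith
  have hnn : 0 ≤ α * (b / a - 1) * M + M := by
    have : 0 ≤ b / a := by positivity
    have h4 : α * (b / a - 1) * M + M = (α * (b / a) + (1 - α)) * M := by ring
    rw [h4]; positivity
  rw [hUt, hMt, ← ENNReal.ofReal_mul hα.le, ← ENNReal.ofReal_mul h1α,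
    ← ENNReal.ofReal_add (by positivity) (by positivity), ENNReal.ofReal_le_ofReal_iff hnn] at key
  have h5 : α * (crossMass μ α Q P).toReal ≤ α * (b / a * M) := by linarith
  have h6 := le_of_mul_le_mul_left h5 hα
  calc a * (crossMass μ α Q P).toReal ≤ a * (b / a * M) := by gcongr
    _ = M * b := by field_simp

/-- First-order condition at a projection, for `α > 1`. -/
theorem crossMass_variation_of_one_lt (hα1 : 1 < α) {Γ : Type*} {f : Γ → X → ℝ}
    {P Q R : Measure X} (hR : Admissible μ α R) (hQ : Q ∈ linearFamily μ α f)
    (hP : P ∈ linearFamily μ α f) (hQ0 : crossMass μ α R Q ≠ 0)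
    (hopt : ∀ P ∈ linearFamily μ α f, relEntropy μ α Q R ≤ relEntropy μ α P R) :
    (powMass μ α Q).toReal * (crossMass μ α R P).toReal
      ≤ (crossMass μ α R Q).toReal * (crossMass μ α Q P).toReal := by
  have hα : 0 < α := by linarith
  have := hQ.1.isProb
  have := hP.1.isProb
  have hQt := hQ.1.crossMass_ne_top hα1 hR
  have hPt := hP.1.crossMass_ne_top hα1 hR
  have hUt := hP.1.crossMass_ne_top hα1 hQ.1
  set a := (crossMass μ α R Q).toReal with ha
  set b := (crossMass μ α R P).toReal with hb
  set M := (powMass μ α Q).toReal with hM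
  have ha0 : 0 < a := ENNReal.toReal_pos hQ0 hQt
  have hb0 : 0 ≤ b := ENNReal.toReal_nonneg
  have hM0 : 0 ≤ M := ENNReal.toReal_nonneg
  have key := le_integral_tangent (μ := μ) (K := α * (b / a - 1) * M) hα1
    (P.measurable_rnDeriv μ).ennreal_toReal (Q.measurable_rnDeriv μ).ennreal_toReal
    (fun _ => ENNReal.toReal_nonneg) (fun _ => ENNReal.toReal_nonneg)
    (hP.1.integrable_rpow hα) (hQ.1.integrable_rpow hα) (by
      intro t ht ht1
      rw [(integral_chord hα ht ht1 hQ hP).2]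
      have hmix := mix_mem_linearFamily hα ht ht1 hQ hP
      have h1 := (relEntropy_le_iff_of_one_lt hα1 hmix.1 hQ.1 hR).1 (hopt _ hmix)
      have h2 := ENNReal.toReal_mono (ENNReal.mul_ne_top hQt
        (ENNReal.rpow_ne_top_of_nonneg (inv_pos.2 hα).le (hmix.1.powMass_ne_top hα))) h1
      rw [ENNReal.toReal_mul, ENNReal.toReal_mul, ← ENNReal.toReal_rpow, ← ENNReal.toReal_rpow,
        toReal_crossMass_mix ht ht1 hQt hPt] at h2
      exact rpow_chord_bound_of_one_lt hα1 ha0 hb0 hM0 ENNReal.toReal_nonneg ht ht1 h2)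
  have hUi := integrable_rpow_of_crossMass_ne_top hUt
  have hU : (crossMass μ α Q P).toReal
      = ∫ x, (P.rnDeriv μ x).toReal * (Q.rnDeriv μ x).toReal ^ (α - 1) ∂μ := by
    rw [toReal_crossMass (ae_rpow_ne_top_of_crossMass_ne_top hUt)]
    exact (integral_rnDeriv_smul hP.1.ac).symm
  have hUi' : Integrable (fun x => (P.rnDeriv μ x).toReal * (Q.rnDeriv μ x).toReal ^ (α - 1)) μ :=
    (integrable_rnDeriv_smul_iff hP.1.ac).2 hUi
  have hI : ∫ x, α * (Q.rnDeriv μ x).toReal ^ (α - 1) *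
        ((P.rnDeriv μ x).toReal - (Q.rnDeriv μ x).toReal) ∂μ
      = α * ((crossMass μ α Q P).toReal - M) := by
    rw [hU, hM, toReal_powMass hα, ← integral_sub hUi' (hQ.1.integrable_rpow hα),
      ← integral_const_mul]
    congr 1
    ext x
    have hq : 0 ≤ (Q.rnDeriv μ x).toReal := ENNReal.toReal_nonneg
    have h1 : (Q.rnDeriv μ x).toReal ^ α
        = (Q.rnDeriv μ x).toReal ^ (α - 1) * (Q.rnDeriv μ x).toReal := by
      rw [← Real.rpow_add_one' hq (by linarith)]
      congr 1; ring
    rw [h1]; ring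
  rw [hI] at key
  have h5 : α * (b / a * M) ≤ α * (crossMass μ α Q P).toReal := by linarith
  have h6 := le_of_mul_le_mul_left h5 hα
  calc M * b = a * (b / a * M) := by field_simp
    _ ≤ a * (crossMass μ α Q P).toReal := by gcongr

end

/-! ### Bounded reweightings and the form of the density -/

/-- A mean-zero function with nonpositive integral against every bounded reweighting of `Q` that
respects the constraints belongs to the constraint span. -/
theorem exists_mem_constraintSpan_of_reweighting {Γ : Type*} {f : Γ → X → ℝ} {Q : Measure X}
    [IsProbabilityMeasure Q] (hf : ∀ γ, Integrable (f γ) Q) (hf0 : ∀ γ, ∫ x, f γ x ∂Q = 0)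
    (hcl : SpanClosedL1 f Q) {u : X → ℝ} (hu : Integrable u Q) (hu0 : ∫ x, u x ∂Q = 0)
    (H : ∀ w : X → ℝ, Measurable w → (∀ x, 0 ≤ w x) → (∀ x, w x ≤ 2) → ∫ x, w x ∂Q = 1 →
      (∀ γ, ∫ x, w x * f γ x ∂Q = 0) → ∫ x, w x * u x ∂Q ≤ 0) :
    ∃ g ∈ constraintSpan f, u =ᵐ[Q] g := by
  refine exists_mem_constraintSpan_of_annihilator hf hcl hu fun h hm ⟨K, hK⟩ hann => ?_
  obtain ⟨x₀⟩ : Nonempty X := nonempty_of_isProbabilityMeasure Q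
  have hK0 : 0 ≤ K := (abs_nonneg _).trans (hK x₀)
  have hhi : Integrable h Q := Integrable.of_bound hm.aestronglyMeasurable K (ae_of_all _ hK)
  set c := ∫ x, h x ∂Q with hc
  have hcK : |c| ≤ K := by
    simpa using norm_integral_le_of_norm_le_const (μ := Q) (f := h) (ae_of_all _ hK)
  have hmul : ∀ {v : X → ℝ}, Integrable v Q → Integrable (fun x => h x * v x) Q := fun hv =>
    hv.bdd_mul hm.aestronglyMeasurable (ae_of_all _ hK)
  have hden : 0 < 2 * K + 1 := by linarith
  have hexp : ∀ (e : ℝ) {v : X → ℝ}, Integrable v Q → ∫ x, v x ∂Q = 0 →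
      ∫ x, (1 + e * (h x - c)) * v x ∂Q = e * ∫ x, h x * v x ∂Q := by
    intro e v hv hv0
    have h1 : ∀ x, (1 + e * (h x - c)) * v x = (1 - e * c) * v x + e * (h x * v x) :=
      fun x => by ring
    simp only [h1]
    rw [integral_add (hv.const_mul _) ((hmul hv).const_mul _), integral_const_mul,
      integral_const_mul, hv0, mul_zero, zero_add]
  -- As `|h - c| ≤ 2 K`, this size of `e` keeps the weight `1 + e (h - c)` in `[0, 2]`; centring at
  -- `c` gives it integral `1`. The two signs of `e` turn the inequality into an equality.
  have hsign : ∀ e : ℝ, |e| = (2 * K + 1)⁻¹ → e * ∫ x, h x * u x ∂Q ≤ 0 := by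
    intro e he
    have hb : ∀ x, |e * (h x - c)| ≤ 1 := by
      intro x
      rw [abs_mul, he, inv_mul_le_iff₀ hden]
      have := abs_sub (h x) c
      linarith [hK x]
    rw [← hexp e hu hu0]
    refine H _ (by fun_prop) (fun x => ?_) (fun x => ?_) ?_ fun γ => ?_
    · linarith [neg_le_of_abs_le (hb x)]
    · linarith [le_of_abs_le (hb x)]
    · have hhc : Integrable (fun x => h x - c) Q := hhi.sub (integrable_const _)
      rw [integral_add (integrable_const _) (hhc.const_mul _), integral_const_mul,
        integral_sub hhi (integrable_const _)]
      simp [← hc]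
    · rw [hexp e (hf γ) (hf0 γ), hann γ, mul_zero]
  have hpos : 0 < (2 * K + 1)⁻¹ := inv_pos.2 hden
  have h1 := hsign _ (abs_of_pos hpos)
  have h2 := hsign (-(2 * K + 1)⁻¹) (by rw [abs_neg, abs_of_pos hpos])
  nlinarith

theorem integral_withDensity_ofReal {Q : Measure X} {w : X → ℝ} (hw : Measurable w)
    (hw0 : ∀ x, 0 ≤ w x) (v : X → ℝ) :
    ∫ x, v x ∂(Q.withDensity fun x => ENNReal.ofReal (w x)) = ∫ x, w x * v x ∂Q := by
  rw [integral_withDensity_eq_integral_toReal_smul hw.ennreal_ofReal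
    (ae_of_all _ fun _ => ENNReal.ofReal_lt_top)]
  simp only [ENNReal.toReal_ofReal (hw0 _), smul_eq_mul]

theorem integrable_withDensity_ofReal {Q : Measure X} {w : X → ℝ} (hw : Measurable w)
    (hw0 : ∀ x, 0 ≤ w x) {B : ℝ} (hwB : ∀ x, w x ≤ B) {v : X → ℝ} (hv : Integrable v Q) :
    Integrable v (Q.withDensity fun x => ENNReal.ofReal (w x)) := by
  rw [integrable_withDensity_iff_integrable_smul₀' hw.ennreal_ofReal.aemeasurable
    (ae_of_all _ fun _ => ENNReal.ofReal_lt_top)]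
  simp only [ENNReal.toReal_ofReal (hw0 _), smul_eq_mul]
  refine hv.bdd_mul hw.aestronglyMeasurable (c := B) (ae_of_all _ fun x => ?_)
  rw [Real.norm_of_nonneg (hw0 x)]
  exact hwB x

theorem crossMass_withDensity_ne_top {μ : Measure X} {α : ℝ} {Z Q : Measure X} {w : X → ℝ}
    (hw : Measurable w) {B : ℝ} (hwB : ∀ x, w x ≤ B)
    (h : crossMass μ α Z Q ≠ ⊤) :
    crossMass μ α Z (Q.withDensity fun x => ENNReal.ofReal (w x)) ≠ ⊤ := by
  rw [crossMass, lintegral_withDensity_eq_lintegral_mul _ hw.ennreal_ofReal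
    ((Z.measurable_rnDeriv μ).pow_const _)]
  refine ((lintegral_mono (g := fun x => ENNReal.ofReal B * Z.rnDeriv μ x ^ (α - 1))
    fun x => ?_).trans_lt ?_).ne
  · simp only [Pi.mul_apply]
    gcongr
    exact hwB x
  · rw [lintegral_const_mul' _ _ ENNReal.ofReal_ne_top]
    exact ENNReal.mul_lt_top ENNReal.ofReal_lt_top h.lt_top

theorem toReal_eq_of_coe_eq_mul_add {x y : ℝ≥0∞} {c g : ℝ} (hx : x ≠ ⊤)
    (h : (x : EReal) = (c : EReal) * (y : EReal) + (g : EReal)) :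
    x.toReal = c * y.toReal + g ∧ (c ≠ 0 → y ≠ ⊤) := by
  lift x to NNReal using hx
  have hxr : ((x : ℝ≥0∞) : EReal) = ((x : ℝ) : EReal) := rfl
  rw [hxr] at h
  induction y using ENNReal.recTopCoe with
  | top =>
    rcases lt_trichotomy c 0 with hc | rfl | hc
    · rw [EReal.coe_ennreal_top, EReal.coe_mul_top_of_neg hc, EReal.bot_add] at h
      exact absurd h (EReal.coe_ne_bot _)
    · simpa using h
    · rw [EReal.coe_ennreal_top, EReal.coe_mul_top_of_pos hc, EReal.top_add_coe] at h
      exact absurd h (EReal.coe_ne_top _)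
  | coe y =>
    have hyr : ((y : ℝ≥0∞) : EReal) = ((y : ℝ) : EReal) := rfl
    rw [hyr] at h
    refine ⟨?_, fun _ => ENNReal.coe_ne_top⟩
    exact_mod_cast h

theorem coe_eq_mul_add_of_toReal_eq {x y : ℝ≥0∞} {c g : ℝ} (hx : x ≠ ⊤) (hy : y ≠ ⊤)
    (h : x.toReal = c * y.toReal + g) :
    (x : EReal) = (c : EReal) * (y : EReal) + (g : EReal) := by
  lift x to NNReal using hx
  lift y to NNReal using hy
  have hxr : ((x : ℝ≥0∞) : EReal) = ((x : ℝ) : EReal) := rfl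
  have hyr : ((y : ℝ≥0∞) : EReal) = ((y : ℝ) : EReal) := rfl
  rw [hxr, hyr]
  exact_mod_cast h

section

variable {μ : Measure X} [SigmaFinite μ] {α : ℝ}

/-- Boundedness of `w` matters: the new density is at most `B q`, so it stays in `L^α(μ)` and the
constraints stay integrable. -/
theorem withDensity_mem_linearFamily (hα : 0 < α) {Γ : Type*} {f : Γ → X → ℝ} {Q : Measure X}
    (hQ : Q ∈ linearFamily μ α f) {w : X → ℝ} (hw : Measurable w) (hw0 : ∀ x, 0 ≤ w x) {B : ℝ}
    (hwB : ∀ x, w x ≤ B) (hw1 : ∫ x, w x ∂Q = 1) (hwf : ∀ γ, ∫ x, w x * f γ x ∂Q = 0) :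
    (Q.withDensity fun x => ENNReal.ofReal (w x)) ∈ linearFamily μ α f := by
  have := hQ.1.isProb
  have hwi : Integrable w Q := Integrable.of_bound hw.aestronglyMeasurable B
    (ae_of_all _ fun x => by rw [Real.norm_of_nonneg (hw0 x)]; exact hwB x)
  have hprob : IsProbabilityMeasure (Q.withDensity fun x => ENNReal.ofReal (w x)) := by
    constructor
    rw [withDensity_apply _ MeasurableSet.univ, Measure.restrict_univ,
      ← ofReal_integral_eq_lintegral_ofReal hwi (ae_of_all _ hw0), hw1, ENNReal.ofReal_one]
  refine ⟨admissible_of_integrable_rpow hα hprob ?_ ?_, fun γ => ⟨?_, ?_⟩⟩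
  · exact (withDensity_absolutelyContinuous _ _).trans hQ.1.ac
  · have hd := Measure.rnDeriv_withDensity_left_of_absolutelyContinuous hQ.1.ac
      (hw.ennreal_ofReal.aemeasurable (μ := μ))
    refine ((hQ.1.integrable_rpow hα).const_mul (B ^ α)).mono'
      ((Measure.measurable_rnDeriv _ _).ennreal_toReal.pow_const α).aestronglyMeasurable ?_
    filter_upwards [hd] with x hx
    rw [hx, ENNReal.toReal_mul, ENNReal.toReal_ofReal (hw0 x),
      Real.mul_rpow (hw0 x) ENNReal.toReal_nonneg, Real.norm_of_nonneg
        (mul_nonneg (Real.rpow_nonneg (hw0 x) _) (Real.rpow_nonneg ENNReal.toReal_nonneg _))]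
    exact mul_le_mul_of_nonneg_right (Real.rpow_le_rpow (hw0 x) (hwB x) hα.le)
      (Real.rpow_nonneg ENNReal.toReal_nonneg _)
  · exact integrable_withDensity_ofReal hw hw0 hwB (hQ.2 γ).1
  · rw [integral_withDensity_ofReal hw hw0, hwf γ]

theorem ae_rnDeriv_ne_zero {Q : Measure X} [SigmaFinite Q] (hQ : Q ≪ μ) :
    ∀ᵐ x ∂Q, Q.rnDeriv μ x ≠ 0 := by
  filter_upwards [Measure.rnDeriv_pos hQ] with x hx using hx.ne'

/-- The parametric form of the density follows from the one-sided first-order condition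
(`s = 1` for `α < 1`, `s = -1` for `α > 1`). -/
theorem exists_density_eq_of_variation (hα : 0 < α) {Γ : Type*} {f : Γ → X → ℝ}
    {Q R : Measure X} (hQ : Q ∈ linearFamily μ α f) (hcl : SpanClosedL1 f Q)
    (hQ0 : crossMass μ α R Q ≠ 0) (hQt : crossMass μ α R Q ≠ ⊤) {s : ℝ} (hs : s ≠ 0)
    (hvar : ∀ P ∈ linearFamily μ α f, crossMass μ α R P ≠ ⊤ → crossMass μ α Q P ≠ ⊤ →
      s * ((crossMass μ α R Q).toReal * (crossMass μ α Q P).toReal) ≤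
        s * ((powMass μ α Q).toReal * (crossMass μ α R P).toReal)) :
    ∃ g ∈ constraintSpan f, ∀ᵐ x ∂μ, Q.rnDeriv μ x ≠ 0 →
      ((Q.rnDeriv μ x ^ (α - 1) : ℝ≥0∞) : EReal) =
        (((powMass μ α Q).toReal / (crossMass μ α R Q).toReal : ℝ) : EReal) *
          ((R.rnDeriv μ x ^ (α - 1) : ℝ≥0∞) : EReal) + (g x : EReal) := by
  have := hQ.1.isProb
  have hself := crossMass_self hα hQ.1
  have hUt : crossMass μ α Q Q ≠ ⊤ := by rw [hself]; exact hQ.1.powMass_ne_top hα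
  set a := (crossMass μ α R Q).toReal with ha
  set M := (powMass μ α Q).toReal with hM
  have ha0 : 0 < a := ENNReal.toReal_pos hQ0 hQt
  have hqt := ae_rpow_ne_top_of_crossMass_ne_top hUt
  have hrt := ae_rpow_ne_top_of_crossMass_ne_top hQt
  have hqi := integrable_rpow_of_crossMass_ne_top hUt
  have hri := integrable_rpow_of_crossMass_ne_top hQt
  let v : X → ℝ := fun x =>
    (Q.rnDeriv μ x).toReal ^ (α - 1) - M / a * (R.rnDeriv μ x).toReal ^ (α - 1)
  have hvi : Integrable v Q := hqi.sub (hri.const_mul _)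
  have hvint : ∀ P : Measure X, crossMass μ α Q P ≠ ⊤ → crossMass μ α R P ≠ ⊤ →
      ∫ x, v x ∂P = (crossMass μ α Q P).toReal - M / a * (crossMass μ α R P).toReal := by
    intro P h1 h2
    simp only [v]
    rw [integral_sub (integrable_rpow_of_crossMass_ne_top h1)
      ((integrable_rpow_of_crossMass_ne_top h2).const_mul _), integral_const_mul,
      toReal_crossMass (ae_rpow_ne_top_of_crossMass_ne_top h1),
      toReal_crossMass (ae_rpow_ne_top_of_crossMass_ne_top h2)]
  -- The constant `M / a` is the one for which `v` has mean zero under `Q`, since `∫ q ^ (α - 1) dQ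
  -- = M` and `∫ r ^ (α - 1) dQ = a`.
  obtain ⟨g, hg, hgu⟩ := exists_mem_constraintSpan_of_reweighting
    (u := fun x => s * v x) (fun γ => (hQ.2 γ).1) (fun γ => (hQ.2 γ).2) hcl (hvi.const_mul s)
    (by
      rw [integral_const_mul, hvint Q hUt hQt, hself, ← ha, ← hM]
      field_simp
      simp)
    (by
      intro w hw hw0 hw2 hw1 hwf
      have hPt := crossMass_withDensity_ne_top hw hw2 hQt
      have hPU := crossMass_withDensity_ne_top hw hw2 hUt
      have h1 := hvar _ (withDensity_mem_linearFamily hα hQ hw hw0 hw2 hw1 hwf) hPt hPU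
      rw [← integral_withDensity_ofReal hw hw0, integral_const_mul, hvint _ hPU hPt]
      generalize (crossMass μ α Q (Q.withDensity fun x => ENNReal.ofReal (w x))).toReal = A at *
      generalize (crossMass μ α R (Q.withDensity fun x => ENNReal.ofReal (w x))).toReal = D at *
      have h2 : s * (A - M / a * D) = (s * (a * A) - s * (M * D)) / a := by field_simp
      rw [h2]
      exact div_nonpos_of_nonpos_of_nonneg (by linarith) ha0.le)
  refine ⟨s⁻¹ • g, Submodule.smul_mem _ _ hg, ?_⟩
  have hQae : ∀ᵐ x ∂Q, ((Q.rnDeriv μ x ^ (α - 1) : ℝ≥0∞) : EReal) =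
        ((M / a : ℝ) : EReal) * ((R.rnDeriv μ x ^ (α - 1) : ℝ≥0∞) : EReal)
          + ((s⁻¹ • g) x : EReal) := by
    filter_upwards [hqt, hrt, hgu] with x h1 h2 h3
    refine coe_eq_mul_add_of_toReal_eq h1 h2 ?_
    rw [Pi.smul_apply, ← h3, smul_eq_mul, ← mul_assoc, inv_mul_cancel₀ hs, one_mul]
    simp only [v, ENNReal.toReal_rpow]
    ring
  -- A `Q`-almost everywhere statement is a `μ`-almost everywhere one on `{q ≠ 0}`.
  rw [← Measure.withDensity_rnDeriv_eq Q μ hQ.1.ac,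
    ae_withDensity_iff (Q.measurable_rnDeriv μ)] at hQae
  rw [Measure.withDensity_rnDeriv_eq Q μ hQ.1.ac] at hQae
  exact hQae

/-! ### From the power law to the projection -/

/-- A power-law density determines `∫ q ^ α dμ` as a positive multiple of `∫ r ^ (α - 1) dQ`. -/
theorem powMass_eq_of_powerLaw (hα : 0 < α) {Γ : Type*} {f : Γ → X → ℝ} {Q R : Measure X}
    (hQ : Q ∈ linearFamily μ α f) {c : ℝ} {g : X → ℝ} (hg : g ∈ constraintSpan f) {N : Set X}
    (h : HasPowerLaw μ α (linearFamily μ α f) R Q c g N) :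
    0 < c ∧ crossMass μ α R Q ≠ ⊤ ∧ 0 < (crossMass μ α R Q).toReal ∧
      (powMass μ α Q).toReal = c * (crossMass μ α R Q).toReal := by
  have := hQ.1.isProb
  have hself := crossMass_self hα hQ.1
  have hUt : crossMass μ α Q Q ≠ ⊤ := by rw [hself]; exact hQ.1.powMass_ne_top hα
  have hM0 : 0 < (powMass μ α Q).toReal :=
    ENNReal.toReal_pos (hQ.1.powMass_ne_zero hα) (hQ.1.powMass_ne_top hα)
  have hqt := ae_rpow_ne_top_of_crossMass_ne_top hUt
  have hqi := integrable_rpow_of_crossMass_ne_top hUt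
  have hgi := integrable_of_mem_constraintSpan (fun γ => (hQ.2 γ).1) hg
  have hg0 := integral_eq_zero_of_mem_constraintSpan (fun γ => (hQ.2 γ).1)
    (fun γ => (hQ.2 γ).2) hg
  have hae : ∀ᵐ x ∂Q, (Q.rnDeriv μ x).toReal ^ (α - 1)
      = c * (R.rnDeriv μ x).toReal ^ (α - 1) + g x ∧ (c ≠ 0 → R.rnDeriv μ x ^ (α - 1) ≠ ⊤) := by
    filter_upwards [hqt, ae_rnDeriv_ne_zero hQ.1.ac, hQ.1.ac.ae_le h.density_off,
      hQ.1.ac.ae_le h.density_on] with x h1 h2 h3 h4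
    rw [ENNReal.toReal_rpow, ENNReal.toReal_rpow]
    exact toReal_eq_of_coe_eq_mul_add h1 (h3 fun hN => h2 (h4 hN))
  have hMint : (powMass μ α Q).toReal = ∫ x, (Q.rnDeriv μ x).toReal ^ (α - 1) ∂Q := by
    rw [← hself, toReal_crossMass hqt]
  -- If `c` were `0`, the power law would give `M = ∫ g dQ = 0`, whereas `M > 0`.
  have hc : c ≠ 0 := by
    rintro rfl
    have : ∫ x, (Q.rnDeriv μ x).toReal ^ (α - 1) ∂Q = ∫ x, g x ∂Q := by
      refine integral_congr_ae ?_
      filter_upwards [hae] with x hx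
      rw [hx.1, zero_mul, zero_add]
    rw [hMint, this, hg0] at hM0
    exact lt_irrefl _ hM0
  have hrt : ∀ᵐ x ∂Q, R.rnDeriv μ x ^ (α - 1) ≠ ⊤ := by
    filter_upwards [hae] with x hx using hx.2 hc
  have hri : Integrable (fun x => (R.rnDeriv μ x).toReal ^ (α - 1)) Q := by
    refine ((hqi.sub hgi).const_mul c⁻¹).congr ?_
    filter_upwards [hae] with x hx
    rw [Pi.sub_apply, hx.1, add_sub_cancel_right, ← mul_assoc, inv_mul_cancel₀ hc, one_mul]
  have hQt := crossMass_ne_top_of_integrable hrt hri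
  have hMc : (powMass μ α Q).toReal = c * (crossMass μ α R Q).toReal := by
    rw [hMint, toReal_crossMass hrt, ← integral_const_mul,
      integral_congr_ae (hae.mono fun x hx => hx.1), integral_add (hri.const_mul c) hgi, hg0,
      add_zero]
  have ha0 : 0 ≤ (crossMass μ α R Q).toReal := ENNReal.toReal_nonneg
  have hcpos : 0 < c := by
    by_contra hneg
    rw [hMc] at hM0
    exact absurd hM0 (not_lt.2 (mul_nonpos_of_nonpos_of_nonneg (not_lt.1 hneg) ha0))
  refine ⟨hcpos, hQt, ?_, hMc⟩
  rw [hMc] at hM0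
  exact (pos_iff_pos_of_mul_pos hM0).1 hcpos

theorem toReal_rpow_mul_rpow (hα : 0 < α) {P Q : Measure X} (hQ : Admissible μ α Q) :
    (powMass μ α P ^ α⁻¹ * powMass μ α Q ^ (1 - α⁻¹)).toReal * (powMass μ α Q ^ α⁻¹).toReal
      = (powMass μ α P ^ α⁻¹).toReal * (powMass μ α Q).toReal := by
  rw [← ENNReal.toReal_mul, mul_assoc, ← ENNReal.rpow_add _ _ (hQ.powMass_ne_zero hα)
    (hQ.powMass_ne_top hα), sub_add_cancel, ENNReal.rpow_one, ENNReal.toReal_mul]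

/-- The power law holds `P`-almost everywhere because `P(N) = 0`, and `∫ g dP = 0`, so `∫ q ^ (α -
1) dP = c ∫ r ^ (α - 1) dP`. Reverse Hölder multiplied by `‖q‖_α` is then the required inequality
times `c`. -/
theorem isForwardProjection_of_powerLaw_of_lt_one (hα : 0 < α) (hα1 : α < 1) {Γ : Type*}
    {f : Γ → X → ℝ} {Q R : Measure X} (hR : Admissible μ α R) (hQ : Q ∈ linearFamily μ α f)
    {c : ℝ} {g : X → ℝ} (hg : g ∈ constraintSpan f) {N : Set X}
    (h : HasPowerLaw μ α (linearFamily μ α f) R Q c g N) :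
    IsForwardProjection μ α (linearFamily μ α f) R Q := by
  obtain ⟨hc, hQt, ha0, hMc⟩ := powMass_eq_of_powerLaw hα hQ hg h
  refine (isForwardProjection_iff hQ).2
    ⟨(relEntropy_lt_top_iff_of_lt_one hα hα1 hQ.1 hR).2 hQt, fun P hP => ?_⟩
  rw [relEntropy_le_iff_of_lt_one hα hα1 hP.1 hQ.1 hR]
  have := hR.isProb
  have hmQ := hQ.1.powMass_ne_top hα
  have hmQ0 := hQ.1.powMass_ne_zero hα
  have hi : 0 ≤ α⁻¹ := (inv_pos.2 hα).le
  rcases eq_or_ne (crossMass μ α R P) ⊤ with hPt | hPt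
  · rw [hPt, ENNReal.top_mul (rpow_ne_zero_of_ne hmQ0 hmQ)]
    exact le_top
  have hPN := h.side_lt_one hα1 P
    ⟨hP, hP.1, (relEntropy_lt_top_iff_of_lt_one hα hα1 hP.1 hR).2 hPt⟩
  have hrt := ae_rpow_ne_top_of_crossMass_ne_top hPt
  have hri := integrable_rpow_of_crossMass_ne_top hPt
  have hgi := integrable_of_mem_constraintSpan (fun γ => (hP.2 γ).1) hg
  have hg0 := integral_eq_zero_of_mem_constraintSpan (fun γ => (hP.2 γ).1)
    (fun γ => (hP.2 γ).2) hg
  have hae : ∀ᵐ x ∂P, Q.rnDeriv μ x ^ (α - 1) ≠ ⊤ ∧ (Q.rnDeriv μ x).toReal ^ (α - 1)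
      = c * (R.rnDeriv μ x).toReal ^ (α - 1) + g x := by
    filter_upwards [hrt, hP.1.ac.ae_le h.density_off, measure_eq_zero_iff_ae_notMem.1 hPN]
      with x h1 h2 h3
    have h4 := h2 h3
    -- The right side of the power law is finite, so the left side is too.
    have hqt : Q.rnDeriv μ x ^ (α - 1) ≠ ⊤ := by
      intro htop
      rw [htop] at h4
      lift R.rnDeriv μ x ^ (α - 1) to NNReal using h1 with y
      have hyr : ((y : ℝ≥0∞) : EReal) = ((y : ℝ) : EReal) := rfl
      rw [hyr, ← EReal.coe_mul, ← EReal.coe_add, EReal.coe_ennreal_top] at h4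
      exact EReal.coe_ne_top _ h4.symm
    rw [ENNReal.toReal_rpow, ENNReal.toReal_rpow]
    exact ⟨hqt, (toReal_eq_of_coe_eq_mul_add hqt h4).1⟩
  have hUt : crossMass μ α Q P ≠ ⊤ := by
    refine crossMass_ne_top_of_integrable (hae.mono fun x hx => hx.1) ?_
    exact ((hri.const_mul c).add hgi).congr (hae.mono fun x hx => hx.2.symm)
  have hU : (crossMass μ α Q P).toReal = c * (crossMass μ α R P).toReal := by
    rw [toReal_crossMass (hae.mono fun x hx => hx.1), toReal_crossMass hrt, ← integral_const_mul,
      integral_congr_ae (hae.mono fun x hx => hx.2), integral_add (hri.const_mul c) hgi, hg0,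
      add_zero]
  have hH := ENNReal.toReal_mono hUt (le_crossMass hα hα1 hP.1 hQ.1)
  have hNQ : 0 ≤ (powMass μ α Q ^ α⁻¹).toReal := ENNReal.toReal_nonneg
  have hH2 := mul_le_mul_of_nonneg_right hH hNQ
  rw [toReal_rpow_mul_rpow hα hQ.1, hMc, hU] at hH2
  rw [← ENNReal.toReal_le_toReal (ENNReal.mul_ne_top hQt
      (ENNReal.rpow_ne_top_of_nonneg hi (hP.1.powMass_ne_top hα)))
    (ENNReal.mul_ne_top hPt (ENNReal.rpow_ne_top_of_nonneg hi hmQ)), ENNReal.toReal_mul,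
    ENNReal.toReal_mul]
  refine le_of_mul_le_mul_left ?_ hc
  linarith

theorem isForwardProjection_of_powerLaw_of_one_lt (hα1 : 1 < α) {Γ : Type*}
    {f : Γ → X → ℝ} {Q R : Measure X} (hR : Admissible μ α R) (hQ : Q ∈ linearFamily μ α f)
    {c : ℝ} {g : X → ℝ} (hg : g ∈ constraintSpan f) {N : Set X}
    (h : HasPowerLaw μ α (linearFamily μ α f) R Q c g N) :
    IsForwardProjection μ α (linearFamily μ α f) R Q := by
  have hα : 0 < α := by linarith
  obtain ⟨hc, hQt, ha0, hMc⟩ := powMass_eq_of_powerLaw hα hQ hg h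
  have hQ0 : crossMass μ α R Q ≠ 0 := fun h0 => by simp [h0] at ha0
  refine (isForwardProjection_iff hQ).2
    ⟨(relEntropy_lt_top_iff_of_one_lt hα1 hQ.1 hR).2 hQ0, fun P hP => ?_⟩
  rw [relEntropy_le_iff_of_one_lt hα1 hP.1 hQ.1 hR]
  have := hR.isProb
  have := hQ.1.isProb
  have hmQ := hQ.1.powMass_ne_top hα
  have hmP := hP.1.powMass_ne_top hα
  have hi : 0 ≤ α⁻¹ := (inv_pos.2 hα).le
  rcases eq_or_ne (crossMass μ α R P) 0 with hP0 | hP0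
  · rw [hP0, zero_mul]
    exact bot_le
  have hside := h.side_one_lt hα1 P
    ⟨hP, hP.1, (relEntropy_lt_top_iff_of_one_lt hα1 hP.1 hR).2 hP0⟩
  have hPt := hP.1.crossMass_ne_top hα1 hR
  have hUt := hP.1.crossMass_ne_top hα1 hQ.1
  have hqt := ae_rpow_ne_top_of_crossMass_ne_top hUt
  have hri := integrable_rpow_of_crossMass_ne_top hPt
  have hqi := integrable_rpow_of_crossMass_ne_top hUt
  have hgi := integrable_of_mem_constraintSpan (fun γ => (hP.2 γ).1) hg
  have hNm := h.measurable_N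
  have hoff : ∫ x in Nᶜ, (Q.rnDeriv μ x).toReal ^ (α - 1) ∂P
      = c * ∫ x in Nᶜ, (R.rnDeriv μ x).toReal ^ (α - 1) ∂P + ∫ x in Nᶜ, g x ∂P := by
    rw [← integral_const_mul, ← integral_add (hri.integrableOn.const_mul c) hgi.integrableOn]
    refine setIntegral_congr_ae hNm.compl ?_
    filter_upwards [hqt, hP.1.ac.ae_le h.density_off] with x h1 h2 h3
    rw [ENNReal.toReal_rpow, ENNReal.toReal_rpow]
    exact (toReal_eq_of_coe_eq_mul_add h1 (h2 h3)).1
  -- On `N` the term in `q` is discarded as nonnegative, and the side inequality absorbs the term in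
  -- `r`.
  have hge : c * (crossMass μ α R P).toReal ≤ (crossMass μ α Q P).toReal := by
    rw [toReal_crossMass hqt, toReal_crossMass (ae_rpow_ne_top_of_crossMass_ne_top hPt),
      ← integral_add_compl hNm hri, ← integral_add_compl hNm hqi, hoff]
    have h1 : 0 ≤ ∫ x in N, (Q.rnDeriv μ x).toReal ^ (α - 1) ∂P :=
      integral_nonneg fun x => Real.rpow_nonneg ENNReal.toReal_nonneg _
    have h2 : c * ∫ x in N, (R.rnDeriv μ x).toReal ^ (α - 1) ∂P ≤ ∫ x in Nᶜ, g x ∂P := hside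
    linarith
  have hH := ENNReal.toReal_mono (ENNReal.mul_ne_top
    (ENNReal.rpow_ne_top_of_nonneg hi hmP)
    (ENNReal.rpow_ne_top_of_ne_zero (hQ.1.powMass_ne_zero hα) hmQ)) (crossMass_le hα1 hP.1 Q)
  have hNQ : 0 ≤ (powMass μ α Q ^ α⁻¹).toReal := ENNReal.toReal_nonneg
  have hH2 := mul_le_mul_of_nonneg_right (hge.trans hH) hNQ
  rw [toReal_rpow_mul_rpow hα hQ.1, hMc] at hH2
  rw [← ENNReal.toReal_le_toReal (ENNReal.mul_ne_top hPt (ENNReal.rpow_ne_top_of_nonneg hi hmQ))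
    (ENNReal.mul_ne_top hQt (ENNReal.rpow_ne_top_of_nonneg hi hmP)), ENNReal.toReal_mul,
    ENNReal.toReal_mul]
  refine le_of_mul_le_mul_left ?_ hc
  linarith

/-! ### From the projection to the power law -/

theorem exists_powerLaw_of_lt_one (hα : 0 < α) (hα1 : α < 1) {Γ : Type*} {f : Γ → X → ℝ}
    {Q R : Measure X} (hR : Admissible μ α R) (hQ : Q ∈ linearFamily μ α f)
    (hcl : SpanClosedL1 f Q) (h : IsForwardProjection μ α (linearFamily μ α f) R Q) :
    ∃ c : ℝ, ∃ g ∈ constraintSpan f, ∃ N : Set X,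
      HasPowerLaw μ α (linearFamily μ α f) R Q c g N := by
  obtain ⟨hfin, hopt⟩ := (isForwardProjection_iff hQ).1 h
  have hQt := (relEntropy_lt_top_iff_of_lt_one hα hα1 hQ.1 hR).1 hfin
  have hQ0 := crossMass_ne_zero_of_lt_one hα hα1 hQ.1 hR
  obtain ⟨g, hg, hden⟩ := exists_density_eq_of_variation (R := R) hα hQ hcl hQ0 hQt one_ne_zero
    (fun P hP hPt _ => by
      rw [one_mul, one_mul]
      exact (crossMass_variation_of_lt_one hα hα1 hR hQ hP hQt hPt hopt).2)
  refine ⟨_, g, hg, {x | Q.rnDeriv μ x = 0},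
    Q.measurable_rnDeriv μ (measurableSet_singleton 0), hden, ae_of_all _ fun x hx => hx, ?_,
    fun h1 => absurd hα1 h1.not_gt⟩
  rintro - P ⟨hP, -, hPfin⟩
  have hPt := (relEntropy_lt_top_iff_of_lt_one hα hα1 hP.1 hR).1 hPfin
  have hU := (crossMass_variation_of_lt_one hα hα1 hR hQ hP hQt hPt hopt).1
  exact measure_eq_zero_iff_ae_notMem.2 (ae_ne_zero_of_crossMass_ne_top hα1 hU)

theorem exists_powerLaw_of_one_lt (hα1 : 1 < α) {Γ : Type*} {f : Γ → X → ℝ}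
    {Q R : Measure X} (hR : Admissible μ α R) (hQ : Q ∈ linearFamily μ α f)
    (hcl : SpanClosedL1 f Q) (h : IsForwardProjection μ α (linearFamily μ α f) R Q) :
    ∃ c : ℝ, ∃ g ∈ constraintSpan f, ∃ N : Set X,
      HasPowerLaw μ α (linearFamily μ α f) R Q c g N := by
  have hα : 0 < α := by linarith
  obtain ⟨hfin, hopt⟩ := (isForwardProjection_iff hQ).1 h
  have hQ0 := (relEntropy_lt_top_iff_of_one_lt hα1 hQ.1 hR).1 hfin
  have hQt := hQ.1.crossMass_ne_top hα1 hR
  obtain ⟨g, hg, hden⟩ := exists_density_eq_of_variation (R := R) (s := -1) hα hQ hcl hQ0 hQt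
    (by norm_num) (fun P hP _ _ => by
      have := crossMass_variation_of_one_lt hα1 hR hQ hP hQ0 hopt
      linarith)
  have hNm : MeasurableSet {x | Q.rnDeriv μ x = 0} :=
    Q.measurable_rnDeriv μ (measurableSet_singleton 0)
  refine ⟨_, g, hg, {x | Q.rnDeriv μ x = 0}, hNm, hden, ae_of_all _ fun x hx => hx,
    fun h1 => absurd hα1 h1.not_gt, ?_⟩
  rintro - P ⟨hP, -, hPfin⟩
  set c := (powMass μ α Q).toReal / (crossMass μ α R Q).toReal with hc
  set N := {x | Q.rnDeriv μ x = 0} with hN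
  have ha0 : 0 < (crossMass μ α R Q).toReal := ENNReal.toReal_pos hQ0 hQt
  have hPt := hP.1.crossMass_ne_top hα1 hR
  have hUt := hP.1.crossMass_ne_top hα1 hQ.1
  have hqt := ae_rpow_ne_top_of_crossMass_ne_top hUt
  have hri := integrable_rpow_of_crossMass_ne_top hPt
  have hqi := integrable_rpow_of_crossMass_ne_top hUt
  have hgi := integrable_of_mem_constraintSpan (fun γ => (hP.2 γ).1) hg
  -- Now `0 ^ (α - 1) = 0`, so `N` contributes nothing to `∫ q ^ (α - 1) dP`; after cancelling the
  -- integrals of `r ^ (α - 1)` over the complement, the variational inequality is the side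
  -- inequality.
  have hon : ∫ x in N, (Q.rnDeriv μ x).toReal ^ (α - 1) ∂P = 0 := by
    refine setIntegral_eq_zero_of_forall_eq_zero fun x hx => ?_
    have hx : Q.rnDeriv μ x = 0 := hx
    rw [hx, ENNReal.toReal_zero, Real.zero_rpow (by linarith)]
  have hoff : ∫ x in Nᶜ, (Q.rnDeriv μ x).toReal ^ (α - 1) ∂P
      = c * ∫ x in Nᶜ, (R.rnDeriv μ x).toReal ^ (α - 1) ∂P + ∫ x in Nᶜ, g x ∂P := by
    rw [← integral_const_mul, ← integral_add (hri.integrableOn.const_mul c) hgi.integrableOn]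
    refine setIntegral_congr_ae hNm.compl ?_
    filter_upwards [hqt, hP.1.ac.ae_le hden] with x h1 h2 h3
    rw [ENNReal.toReal_rpow, ENNReal.toReal_rpow]
    exact (toReal_eq_of_coe_eq_mul_add h1 (h2 h3)).1
  have hvar : c * (crossMass μ α R P).toReal ≤ (crossMass μ α Q P).toReal := by
    rw [hc, div_mul_eq_mul_div, div_le_iff₀ ha0, mul_comm (crossMass μ α Q P).toReal]
    exact crossMass_variation_of_one_lt hα1 hR hQ hP hQ0 hopt
  rw [toReal_crossMass hqt, toReal_crossMass (ae_rpow_ne_top_of_crossMass_ne_top hPt),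
    ← integral_add_compl hNm hri, ← integral_add_compl hNm hqi, hoff, hon] at hvar
  rw [SideIneq]
  linarith

/-- As `∫ g dP = 0`, the integral of `g` over the complement of `N` is minus its integral over `N`.
-/
theorem sideIneq_iff (hα1 : 1 < α) {Γ : Type*} {f : Γ → X → ℝ} {P R : Measure X}
    (hR : Admissible μ α R) (hP : P ∈ linearFamily μ α f) (c : ℝ) {g : X → ℝ}
    (hg : g ∈ constraintSpan f) {N : Set X} (hN : MeasurableSet N) :
    SideIneq μ α R c g N P ↔
      ∫ x in N, (c * (R.rnDeriv μ x).toReal ^ (α - 1) + g x) ∂P ≤ 0 := by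
  have hri := integrable_rpow_of_crossMass_ne_top (hP.1.crossMass_ne_top hα1 hR)
  have hgi := integrable_of_mem_constraintSpan (fun γ => (hP.2 γ).1) hg
  have hg0 := integral_eq_zero_of_mem_constraintSpan (fun γ => (hP.2 γ).1)
    (fun γ => (hP.2 γ).2) hg
  rw [← integral_add_compl hN hgi] at hg0
  rw [integral_add (hri.integrableOn.const_mul c) hgi.integrableOn, integral_const_mul, SideIneq]
  constructor <;> intro h <;> linarith

end

end RelAlpha


theorem mainTheorem5 {X : Type*} [MeasurableSpace X] (μ : MeasureTheory.Measure X)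
    [MeasureTheory.SigmaFinite μ] (α : ℝ) (hα : 0 < α) (hα1 : α ≠ 1)
    {Γ : Type*} (f : Γ → X → ℝ) (hf : ∀ γ, Measurable (f γ))
    (R : MeasureTheory.Measure X) (hR : RelAlpha.Admissible μ α R) :
    (Finite Γ → ∀ P ∈ RelAlpha.linearFamily μ α f, RelAlpha.SpanClosedL1 f P) ∧
    ((∀ P ∈ RelAlpha.linearFamily μ α f, RelAlpha.SpanClosedL1 f P) →
      (∀ Q ∈ RelAlpha.linearFamily μ α f,
        (RelAlpha.IsForwardProjection μ α (RelAlpha.linearFamily μ α f) R Q ↔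
          ∃ c : ℝ, ∃ g ∈ RelAlpha.constraintSpan f, ∃ N : Set X,
            RelAlpha.HasPowerLaw μ α (RelAlpha.linearFamily μ α f) R Q c g N)) ∧
      (1 < α → ∀ (c : ℝ), ∀ g ∈ RelAlpha.constraintSpan f, ∀ N : Set X, MeasurableSet N →
        ∀ P ∈ RelAlpha.linearFamily μ α f,
          (RelAlpha.SideIneq μ α R c g N P ↔
            ∫ x in N, (c * (R.rnDeriv μ x).toReal ^ (α - 1) + g x) ∂P ≤ 0))) := by
  refine ⟨fun _ P hP => RelAlpha.spanClosedL1_of_finite fun γ => (hP.2 γ).1, fun hcl =>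
    ⟨fun Q hQ => ⟨fun h => ?_, ?_⟩, fun h1 c g hg N hN P hP =>
      RelAlpha.sideIneq_iff h1 hR hP c hg hN⟩⟩
  · rcases lt_or_gt_of_ne hα1 with h1 | h1
    · exact RelAlpha.exists_powerLaw_of_lt_one hα h1 hR hQ (hcl Q hQ) h
    · exact RelAlpha.exists_powerLaw_of_one_lt h1 hR hQ (hcl Q hQ) h
  · rintro ⟨c, g, hg, N, h⟩
    rcases lt_or_gt_of_ne hα1 with h1 | h1
    · exact RelAlpha.isForwardProjection_of_powerLaw_of_lt_one hα h1 hR hQ hg h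
    · exact RelAlpha.isForwardProjection_of_powerLaw_of_one_lt h1 hR hQ hg h
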